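/- Let $p>1$, $q\ge p-1$. For $m>q$, call $u:[0,\infty)\to\mathbb R$ a positive ground state if $u>0$ on $[0,\infty)$, $u$ and $|u'|^{p-2}u'$ are differentiable on $(0,\infty)$ and $$(|u'|^{p-2}u')'+u^m=u^q\ \text{ for } 0<r<\infty,\qquad u'(0)=0,\qquad \lim_{r\to\infty}u(r)=0 .$$ Write $B(x;a,b)=\int_0^x t^{a-1}(1-t)^{b-1}\,dt$ for the incomplete Beta function, $\mathcal B(a,b)=B(1;a,b)$, and $$\bar C=\Big(\tfrac{p}{p-1}\Big)^{1/p}(m-q)(m+1)^{\frac{1+q-p}{p(m-q)}}(q+1)^{\frac{p-m-1}{p(m-q)}},\qquad \theta=\frac{p(m-q)}{(m+1)[(p-q-1)+p(q+1)]},$$ $$\ell=\frac{m-q}{(m+1)[(p-1)(q+1)+p]},\qquad \eta_1=(p-1)(m+1)+p,\qquad \eta_2=(p-1)(q+1)+p .$$ **1. Closed form.** For every $m>q$, the function $x\mapsto B\big(x;1-\frac1p,\frac{p-1-q}{p(m-q)}\big)$ is a bijection of $[0,1)$ onto $[0,\infty)$; let $B^{-1}\big(\cdot\,;1-\frac1p,\frac{p-1-q}{p(m-q)}\big)$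 be its inverse. There is exactly one positive ground state $u_{c,m}$, and $$u_{c,m}(r)=\Big(\frac{m+1}{q+1}\Big)^{\frac1{m-q}}\Big(1-B^{-1}\big(\bar C r;1-\tfrac1p,\tfrac{p-1-q}{p(m-q)}\big)\Big)^{\frac1{m-q}},\qquad r\ge 0 .$$ It satisfies $u_{c,m}'(r)<0$ for $r>0$, and the function $x\mapsto u_{c,m}(|x|)$ belongs to $L^{q+1}(\mathbb R)$ and has a weak derivative in $L^p(\mathbb R)$. **2. Best constant.** For every $m>q$, the smallest constant $C_{q,m,p}\ge 0$ such that $$\|v\|_{L^{m+1}(\mathbb R)}\le C_{q,m,p}\,\|v\|_{L^{q+1}(\mathbb R)}^{1-\theta}\,\|v'\|_{L^p(\mathbb R)}^{\theta}$$ for all real-valued $v\in L^{q+1}(\mathbb R)$ with weak derivative $v'\in L^p(\mathbb R)$ exists, and $$C_{q,m,p}=\left(\frac{2^p(p-1)^{1-p}\,\eta_1^{\frac{\eta_1}{m-q}}}{(m-q)^{2p-1}\,\eta_2^{\frac{\eta_2}{m-q}}}\ \mathcal B\Big(\frac{\eta_2}{p(m-q)},\frac{2p-1}{p}\Big)^{p}\right)^{-\ell}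 =\theta^{-\frac{\theta}{p}}(1-\theta)^{\frac{\theta}{p}-\frac1{m+1}}M_c^{-\theta},\quad M_c=\int_{\mathbb R}u_{c,m}(|x|)^{q+1}\,dx .$$ **3. Decay uniform in $m$.** There is $r_*>0$, depending only on $p$ and $q$, such that: * if $q>p-1$, there is $C>0$ depending only on $p,q$ such that for all $m>2q+1$ $$u_{c,m}(r)+r|u_{c,m}'(r)|\le C\,r^{-\frac{p}{q+1-p}}\qquad\text{for } r\ge 2r_*;$$ * if $q=p-1$, there is $C>0$ depending only on $p,q$ such that for all $m>2q+1$ $$u_{c,m}(r)\le e^{-Cr}\qquad\text{for } r\ge 2r_* .$$ -/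

import Mathlib

open MeasureTheory Set Filter Topology

noncomputable section

namespace GNOneDim

/-- The incomplete Beta function `B(x; a, b) = ∫₀ˣ t^(a-1) (1-t)^(b-1) dt`. -/
def incBeta (x a b : ℝ) : ℝ := ∫ t in (0 : ℝ)..x, t ^ (a - 1) * (1 - t) ^ (b - 1)

/-- The complete Beta function `𝓑(a, b) = ∫₀¹ t^(a-1) (1-t)^(b-1) dt`. -/
def completeBeta (a b : ℝ) : ℝ := incBeta 1 a b

/-- The inverse `y ↦ B⁻¹(y; a, b)` of `x ↦ B(x; a, b)`, with values in `[0, 1)`. -/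
def incBetaInv (y a b : ℝ) : ℝ := Function.invFunOn (fun x => incBeta x a b) (Ico 0 1) y

/-- `u`, looked at on `[0, ∞)`, is a positive solution of
`(|u'|^(p-2) u')' + u^m = u^q` on `0 < r < ∞`, `u'(0) = 0`, `u(r) → 0` as `r → ∞`
(the radial equation in dimension one; only the values of `u` on `[0, ∞)` matter). -/
structure IsPositiveSolution (p q m : ℝ) (u : ℝ → ℝ) : Prop where
  pos : ∀ r, 0 ≤ r → 0 < u r
  differentiableAt : ∀ r, 0 < r → DifferentiableAt ℝ u r
  differentiableAt_flux : ∀ r, 0 < r →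
    DifferentiableAt ℝ (fun s => |deriv u s| ^ (p - 2) * deriv u s) r
  equation : ∀ r, 0 < r →
    deriv (fun s => |deriv u s| ^ (p - 2) * deriv u s) r + u r ^ m = u r ^ q
  deriv_zero : HasDerivWithinAt u 0 (Ici 0) 0
  tendsto_zero : Tendsto u atTop (𝓝 0)

/-- `g` is the weak (distributional) derivative of `v` on the real line. -/
def HasWeakDeriv (v g : ℝ → ℝ) : Prop :=
  LocallyIntegrable v volume ∧ LocallyIntegrable g volume ∧
    ∀ φ : ℝ → ℝ, ContDiff ℝ (⊤ : ℕ∞) φ → HasCompactSupport φ →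
      ∫ x, v x * deriv φ x = -∫ x, g x * φ x

/-- `v ∈ L^(q+1)(ℝ)` and `g ∈ L^p(ℝ)` is its weak derivative. -/
def MemX (p q : ℝ) (v g : ℝ → ℝ) : Prop :=
  MemLp v (ENNReal.ofReal (q + 1)) volume ∧ MemLp g (ENNReal.ofReal p) volume ∧ HasWeakDeriv v g

/-- The interpolation exponent in dimension one. -/
def theta (p q m : ℝ) : ℝ := p * (m - q) / ((m + 1) * ((p - q - 1) + p * (q + 1)))

/-- The inequality `‖v‖_{m+1} ≤ K ‖v‖_{q+1}^(1-θ) ‖v'‖_p^θ` holds for all `v ∈ L^(q+1)(ℝ)` with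
`v' ∈ L^p(ℝ)`. The right-hand side is finite, so `v ∈ L^(m+1)(ℝ)` is part of the claim. -/
def GNInequality (p q m K : ℝ) : Prop :=
  ∀ v g : ℝ → ℝ, MemX p q v g →
    eLpNorm v (ENNReal.ofReal (m + 1)) volume ≤
      ENNReal.ofReal K * eLpNorm v (ENNReal.ofReal (q + 1)) volume ^ (1 - theta p q m) *
        eLpNorm g (ENNReal.ofReal p) volume ^ theta p q m

/-- `K` is the smallest nonnegative constant for which the inequality holds. -/
def IsBestConstant (p q m K : ℝ) : Prop := IsLeast {K' : ℝ | 0 ≤ K' ∧ GNInequality p q m K'} K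

/-- The constant `C̄` of the closed form. -/
def Cbar (p q m : ℝ) : ℝ :=
  (p / (p - 1)) ^ (1 / p) * (m - q) * (m + 1) ^ ((1 + q - p) / (p * (m - q))) *
    (q + 1) ^ ((p - m - 1) / (p * (m - q)))

/-- The closed form
`((m+1)/(q+1))^(1/(m-q)) (1 - B⁻¹(C̄ r; 1 - 1/p, (p-1-q)/(p(m-q))))^(1/(m-q))`. -/
def closedForm (p q m r : ℝ) : ℝ :=
  ((m + 1) / (q + 1)) ^ (1 / (m - q)) *
    (1 - incBetaInv (Cbar p q m * r) (1 - 1 / p) ((p - 1 - q) / (p * (m - q)))) ^ (1 / (m - q))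

/-- `η₁ = (p-1)(m+1) + p`. -/
def eta1 (p m : ℝ) : ℝ := (p - 1) * (m + 1) + p

/-- `η₂ = (p-1)(q+1) + p`. -/
def eta2 (p q : ℝ) : ℝ := (p - 1) * (q + 1) + p

/-- `ℓ = (m-q) / ((m+1) ((p-1)(q+1) + p))`. -/
def ell (p q m : ℝ) : ℝ := (m - q) / ((m + 1) * ((p - 1) * (q + 1) + p))

/-- The explicit value of the best constant. -/
def sharpConst (p q m : ℝ) : ℝ :=
  ((2 ^ p * (p - 1) ^ (1 - p) * eta1 p m ^ (eta1 p m / (m - q))) /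
      ((m - q) ^ (2 * p - 1) * eta2 p q ^ (eta2 p q / (m - q))) *
    completeBeta (eta2 p q / (p * (m - q))) ((2 * p - 1) / p) ^ p) ^ (-ell p q m)

/-- The best constant expressed through the mass `M` of the ground state,
`θ^(-θ/p) (1-θ)^(θ/p - 1/(m+1)) M^(-θ)`. -/
def massConst (p q m M : ℝ) : ℝ :=
  theta p q m ^ (-(theta p q m / p)) *
    (1 - theta p q m) ^ (theta p q m / p - 1 / (m + 1)) * M ^ (-theta p q m)

end GNOneDim

end

/-! Ground states. Multiplying the equation by u' gives a first integral: |u'|^p - p/(p-1) F(u) is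
constant, where F(s) = s^(q+1)/(q+1) - s^(m+1)/(m+1). The decay of u forces the constant to be 0,
and u'(0) = 0 forces u(0) to be the positive zero `peak` of F. Hence u' = -(p/(p-1) F(u))^(1/p), an
autonomous first order equation. With X = 1 - (u/u(0))^(m-q) it becomes d/dr B(X) = C̄, so X is the
inverse incomplete Beta function of C̄ r; the condition q ≥ p-1 makes B diverge at 1, so that the
formula is defined for all r (`IsPositiveSolution.eq_closedForm`, `isPositiveSolution_closedForm`).
The decay estimates come from the same equation: u falls below 1 before a radius independent of m,
and from there on -u' is comparable to u^((q+1)/p).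

Best constant. Let w have supremum M of |w|, and put H(s) = (M^(m-q)|s|^(q+1) -
|s|^(m+1))^((p-1)/p). A function that is small far out on both sides sweeps [0, M] twice, so 2∫₀^M H
≤ ∫|w'|H(w), and Hölder bounds the right side by ‖w'‖_p (M^(m-q)∫|w|^(q+1) - ∫|w|^(m+1))^((p-1)/p)
(`IsLebesguePrimitive.sup_interpolation`). The left side is an explicit power of M times a Beta
integral. Maximising over M removes the height (`le_powConst_of_sup`) and gives the inequality with
the explicit constant.

Sharpness. For the ground state the first integral is the equality case of Hölder with M = `peak`.
The proof checks sharpness by calculation: the energy identity and the equation tested with u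
express all norms through the mass (`IsPositiveSolution.integrals_eq`), the energy is also an
explicit Beta integral, and comparing the two identifies `sharpConst` with `massConst`, which is the
quotient of norms of the ground state. -/

namespace GNOneDim

/-! ### First integral of the equation and monotonicity of ground states -/

/-- The potential `s^(q+1)/(q+1) - s^(m+1)/(m+1)`. -/
noncomputable def potential (q m s : ℝ) : ℝ := s ^ (q + 1) / (q + 1) - s ^ (m + 1) / (m + 1)

/-- The positive zero of the potential. -/
noncomputable def peak (q m : ℝ) : ℝ := ((m + 1) / (q + 1)) ^ (1 / (m - q))

lemma hasDerivAt_potential {q m s : ℝ} (hq : q + 1 ≠ 0) (hm : m + 1 ≠ 0) (hs : 0 < s) :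
    HasDerivAt (potential q m) (s ^ q - s ^ m) s := by
  unfold potential
  have h1 := ((Real.hasDerivAt_rpow_const (p := q + 1) (Or.inl hs.ne')).div_const (q + 1))
  have h2 := ((Real.hasDerivAt_rpow_const (p := m + 1) (Or.inl hs.ne')).div_const (m + 1))
  refine (h1.sub h2).congr_deriv ?_
  rw [mul_div_cancel_left₀ _ hq, mul_div_cancel_left₀ _ hm, add_sub_cancel_right,
    add_sub_cancel_right]

lemma continuous_potential {q m : ℝ} (hq : 0 < q + 1) (hm : 0 < m + 1) :
    Continuous (potential q m) := by
  unfold potential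
  exact ((Real.continuous_rpow_const hq.le).div_const _).sub
    ((Real.continuous_rpow_const hm.le).div_const _)

lemma potential_zero {q m : ℝ} (hq : 0 < q + 1) (hm : 0 < m + 1) : potential q m 0 = 0 := by
  simp [potential, Real.zero_rpow hq.ne', Real.zero_rpow hm.ne']

lemma one_lt_peak {q m : ℝ} (hq : 0 < q + 1) (hm : q < m) : 1 < peak q m := by
  unfold peak
  apply Real.one_lt_rpow
  · rw [one_lt_div hq]; linarith
  · have : 0 < m - q := by linarith
    positivity

lemma peak_pos {q m : ℝ} (hq : 0 < q + 1) (hm : q < m) : 0 < peak q m :=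
  one_pos.trans (one_lt_peak hq hm)

lemma peak_rpow {q m : ℝ} (hq : 0 < q + 1) (hm : q < m) :
    peak q m ^ (m - q) = (m + 1) / (q + 1) := by
  unfold peak
  have : m - q ≠ 0 := by linarith
  rw [← Real.rpow_mul (by apply div_nonneg <;> linarith), one_div_mul_cancel this, Real.rpow_one]

/-- Since `peak` to the power m-q equals (m+1)/(q+1), the sign of the potential is that of 1 -
(s/peak)^(m-q), the quantity that later becomes the Beta variable. -/
lemma potential_eq {q m s : ℝ} (hq : 0 < q + 1) (hm : q < m) (hs : 0 < s) :
    potential q m s = s ^ (q + 1) / (q + 1) * (1 - (s / peak q m) ^ (m - q)) := by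
  have hm1 : 0 < m + 1 := by linarith
  rw [Real.div_rpow hs.le (peak_pos hq hm).le, peak_rpow hq hm, potential]
  have : s ^ (m + 1) = s ^ (q + 1) * s ^ (m - q) := by
    rw [← Real.rpow_add hs]; congr 1; ring
  rw [this]
  field_simp

lemma div_peak_rpow_lt_one_iff {q m s : ℝ} (hq : 0 < q + 1) (hm : q < m) (hs : 0 < s) :
    (s / peak q m) ^ (m - q) < 1 ↔ s < peak q m := by
  have h := peak_pos hq hm
  rw [Real.rpow_lt_one_iff_of_pos (by positivity), one_lt_div h, div_lt_one h]
  constructor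
  · rintro (h1 | h1)
    · linarith
    · exact h1.1
  · intro h1; right; exact ⟨h1, by linarith⟩

lemma potential_pos_iff {q m s : ℝ} (hq : 0 < q + 1) (hm : q < m) (hs : 0 < s) :
    0 < potential q m s ↔ s < peak q m := by
  rw [potential_eq hq hm hs, ← div_peak_rpow_lt_one_iff hq hm hs, mul_pos_iff_of_pos_left
    (by positivity), sub_pos]

lemma potential_peak {q m : ℝ} (hq : 0 < q + 1) (hm : q < m) : potential q m (peak q m) = 0 := by
  rw [potential_eq hq hm (peak_pos hq hm), div_self (peak_pos hq hm).ne', Real.one_rpow]; simp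

lemma potential_neg {q m s : ℝ} (hq : 0 < q + 1) (hm : q < m) (hs : peak q m < s) :
    potential q m s < 0 := by
  have h := peak_pos hq hm
  rw [potential_eq hq hm (h.trans hs)]
  have : 1 < (s / peak q m) ^ (m - q) :=
    Real.one_lt_rpow ((one_lt_div h).2 hs) (by linarith)
  have h2 : 0 < s ^ (q + 1) / (q + 1) := div_pos (Real.rpow_pos_of_pos (h.trans hs) _) hq
  nlinarith

/-- A function with a finite limit at infinity has arbitrarily small slopes near infinity. -/
lemma not_eventually_le_abs_deriv {f : ℝ → ℝ} {l c : ℝ}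
    (hf : ∀ r, 0 < r → DifferentiableAt ℝ f r) (hl : Tendsto f atTop (𝓝 l)) (hc : 0 < c) :
    ¬ ∀ᶠ r in atTop, c ≤ |deriv f r| := by
  intro h
  have h1 : Tendsto (fun r => f (r + 1) - f r) atTop (𝓝 0) := by
    simpa using (hl.comp (tendsto_atTop_add_const_right _ 1 tendsto_id)).sub hl
  have h2 : ∀ᶠ r in atTop, |f (r + 1) - f r| < c := by
    have := (tendsto_order.1 h1.abs).2 c (by simpa using hc)
    exact this
  obtain ⟨R, hR⟩ := eventually_atTop.1 (h.and (h2.and (eventually_gt_atTop 0)))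
  have hR0 := (hR R le_rfl).2.2
  obtain ⟨x, hx, hx'⟩ := exists_deriv_eq_slope f (show R < R + 1 by linarith)
    (fun y hy => (hf y (by linarith [hy.1])).continuousAt.continuousWithinAt)
    (fun y hy => (hf y (by linarith [hy.1])).differentiableWithinAt)
  have h3 := (hR x hx.1.le).1
  rw [hx'] at h3
  have h4 := (hR R le_rfl).2.1
  simp only [add_sub_cancel_left, div_one] at h3
  linarith

/-- If `f` has a vanishing one-sided derivative at `0`, slopes close to `0` are small. -/
lemma not_eventually_le_abs_deriv_zero {f : ℝ → ℝ} {c : ℝ}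
    (hf : ∀ r, 0 < r → DifferentiableAt ℝ f r) (hl : HasDerivWithinAt f 0 (Ici 0) 0)
    (hc : 0 < c) : ¬ ∀ᶠ r in 𝓝[>] (0 : ℝ), c ≤ |deriv f r| := by
  intro h
  have h1 : Tendsto (slope f 0) (𝓝[>] 0) (𝓝 0) := by
    have := hasDerivWithinAt_iff_tendsto_slope.1 hl
    simpa using this
  have h2 : ∀ᶠ r in 𝓝[>] (0 : ℝ), |slope f 0 r| < c := by
    have := (tendsto_order.1 h1.abs).2 c (by simpa using hc)
    exact this
  obtain ⟨b, hb, hb'⟩ := mem_nhdsGT_iff_exists_Ioc_subset.1 (h.and h2)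
  have hb0 : (0 : ℝ) < b := hb
  obtain ⟨x, hx, hx'⟩ := exists_deriv_eq_slope f hb0
    (fun y hy => by
      rcases hy.1.eq_or_lt with h0 | h0
      · rw [← h0]; exact hl.continuousWithinAt.mono Icc_subset_Ici_self
      · exact (hf y h0).continuousAt.continuousWithinAt)
    (fun y hy => (hf y hy.1).differentiableWithinAt)
  have h3 := (hb' ⟨hx.1, hx.2.le⟩).1
  have h4 := (hb' ⟨hb0, le_rfl⟩).2
  rw [hx'] at h3
  rw [slope_def_field] at h4
  linarith

namespace IsPositiveSolution

variable {p q m : ℝ} {u : ℝ → ℝ}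

/-- Only the flux w = |u'|^(p-2)u' is known to be differentiable, not u'. So |u'|^p is written as
|w|^(p/(p-1)), whose derivative is p/(p-1) u' w', and w' is read off from the equation. -/
lemma energy_const (h : IsPositiveSolution p q m u) (hp : 1 < p) (hq : 0 < q + 1)
    (hm : 0 < m + 1) : ∃ E : ℝ, ∀ r, 0 < r →
      |deriv u r| ^ p = p / (p - 1) * potential q m (u r) + E := by
  have hp1 : 0 < p - 1 := by linarith
  set w : ℝ → ℝ := fun s => |deriv u s| ^ (p - 2) * deriv u s with hw
  have habs : ∀ r, |w r| = |deriv u r| ^ (p - 1) := by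
    intro r
    simp only [hw, abs_mul, abs_of_nonneg (Real.rpow_nonneg (abs_nonneg (deriv u r)) _)]
    rcases (abs_nonneg (deriv u r)).eq_or_lt with h0 | h0
    · rw [← h0, Real.zero_rpow hp1.ne', mul_zero]
    · rw [← Real.rpow_add_one h0.ne']; congr 1; ring
  have hpw : ∀ r, |w r| ^ (p / (p - 1)) = |deriv u r| ^ p := by
    intro r
    rw [habs, ← Real.rpow_mul (abs_nonneg _)]
    congr 1; field_simp
  -- The map y ↦ |y|^(p-2) y is inverted by the same map with the conjugate exponent p/(p-1).
  have hinv : ∀ r, |w r| ^ (p / (p - 1) - 2) * w r = deriv u r := by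
    intro r
    rcases (abs_nonneg (deriv u r)).eq_or_lt with h0 | h0
    · have : deriv u r = 0 := abs_eq_zero.1 h0.symm
      simp [hw, this]
    · rw [habs, ← Real.rpow_mul (abs_nonneg _)]
      simp only [hw]
      rw [← mul_assoc, ← Real.rpow_add h0]
      have : (p - 1) * (p / (p - 1) - 2) + (p - 2) = 0 := by field_simp; ring
      rw [this, Real.rpow_zero, one_mul]
  have hP : 1 < p / (p - 1) := by rw [one_lt_div hp1]; linarith
  have hder : ∀ r, 0 < r → HasDerivAt
      (fun s => |w s| ^ (p / (p - 1)) - p / (p - 1) * potential q m (u s)) 0 r := by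
    intro r hr
    have hwd : HasDerivAt w (deriv w r) r := (h.differentiableAt_flux r hr).hasDerivAt
    have h1 := (hasDerivAt_abs_rpow (w r) hP).comp r hwd
    have h2 := ((hasDerivAt_potential (q := q) (m := m) hq.ne' hm.ne' (h.pos r hr.le)).comp r
      (h.differentiableAt r hr).hasDerivAt).const_mul (p / (p - 1))
    refine (h1.sub h2).congr_deriv ?_
    have h3 : deriv w r = u r ^ q - u r ^ m := by
      have := h.equation r hr
      linarith
    rw [h3, mul_assoc (p / (p - 1)), hinv]
    ring
  refine ⟨|w 1| ^ (p / (p - 1)) - p / (p - 1) * potential q m (u 1), fun r hr => ?_⟩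
  have := isOpen_Ioi.is_const_of_deriv_eq_zero (s := Ioi (0 : ℝ)) isPreconnected_Ioi
    (fun x hx => (hder x hx).differentiableAt.differentiableWithinAt)
    (fun x hx => (hder x hx).deriv) (x := r) (y := 1) hr (by simp)
  rw [hpw] at this
  rw [← this]; ring

/-- The constant is the limit of |u'|^p at infinity, hence nonnegative. If it were positive, |u'|
would stay bounded below near infinity, which is incompatible with u → 0. -/
lemma energy (h : IsPositiveSolution p q m u) (hp : 1 < p) (hq : 0 < q + 1)
    (hm : 0 < m + 1) : ∀ r, 0 < r → |deriv u r| ^ p = p / (p - 1) * potential q m (u r) := by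
  obtain ⟨E, hE⟩ := h.energy_const hp hq hm
  have hlim : Tendsto (fun r => |deriv u r| ^ p) atTop (𝓝 E) := by
    have h1 : Tendsto (fun r => p / (p - 1) * potential q m (u r) + E) atTop
        (𝓝 (p / (p - 1) * potential q m 0 + E)) :=
      (((continuous_potential hq hm).continuousAt.tendsto.comp h.tendsto_zero).const_mul
        _).add_const _
    rw [potential_zero hq hm, mul_zero, zero_add] at h1
    refine h1.congr' ?_
    filter_upwards [eventually_gt_atTop 0] with r hr using (hE r hr).symm
  have hE0 : 0 ≤ E := ge_of_tendsto' hlim (fun r => by positivity)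
  rcases hE0.eq_or_lt with h0 | h0
  · intro r hr; rw [hE r hr, ← h0, add_zero]
  · exfalso
    refine not_eventually_le_abs_deriv (c := (E / 2) ^ (1 / p)) h.differentiableAt h.tendsto_zero
      (by positivity) ?_
    filter_upwards [(tendsto_order.1 hlim).1 (E / 2) (by linarith)] with r hr
    have := Real.rpow_le_rpow (by positivity) hr.le (show 0 ≤ 1 / p by positivity)
    rwa [← Real.rpow_mul (abs_nonneg _), mul_one_div_cancel (by positivity), Real.rpow_one] at this

lemma continuousOn (h : IsPositiveSolution p q m u) : ContinuousOn u (Ici 0) := by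
  intro y hy
  rcases (mem_Ici.1 hy).eq_or_lt with h0 | h0
  · rw [← h0]; exact h.deriv_zero.continuousWithinAt
  · exact (h.differentiableAt y h0).continuousAt.continuousWithinAt

/-- Continuity of u' at 0 is not assumed. By the first integral |u'|^p nevertheless has a limit at
0+, and a positive limit would contradict the vanishing one-sided derivative. So the potential
vanishes at u(0), which is positive. -/
lemma apply_zero (h : IsPositiveSolution p q m u) (hp : 1 < p) (hq : 0 < q + 1) (hm : q < m) :
    u 0 = peak q m := by
  have hm1 : 0 < m + 1 := by linarith
  have hp1 : 0 < p - 1 := by linarith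
  have hE := h.energy hp hq hm1
  set E := p / (p - 1) * potential q m (u 0)
  have hlim : Tendsto (fun r => |deriv u r| ^ p) (𝓝[>] 0) (𝓝 E) := by
    have h1 : Tendsto (fun r => p / (p - 1) * potential q m (u r)) (𝓝[>] 0) (𝓝 E) :=
      (((continuous_potential hq hm1).continuousAt.tendsto.comp
        (h.deriv_zero.continuousWithinAt.mono Ioi_subset_Ici_self)).const_mul _)
    refine h1.congr' ?_
    filter_upwards [self_mem_nhdsWithin] with r hr using (hE r hr).symm
  have hE0 : 0 ≤ E := ge_of_tendsto' hlim (fun r => by positivity)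
  have hEle : ¬ 0 < E := by
    intro h0
    refine not_eventually_le_abs_deriv_zero (c := (E / 2) ^ (1 / p)) h.differentiableAt
      h.deriv_zero (by positivity) ?_
    filter_upwards [(tendsto_order.1 hlim).1 (E / 2) (by linarith)] with r hr
    have := Real.rpow_le_rpow (by positivity) hr.le (show 0 ≤ 1 / p by positivity)
    rwa [← Real.rpow_mul (abs_nonneg _), mul_one_div_cancel (by positivity), Real.rpow_one] at this
  have h0 := h.pos 0 le_rfl
  have hc : 0 < p / (p - 1) := by positivity
  rcases lt_trichotomy (u 0) (peak q m) with h1 | h1 | h1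
  · exact absurd (mul_pos hc ((potential_pos_iff hq hm h0).2 h1)) hEle
  · exact h1
  · have := mul_neg_of_pos_of_neg hc (potential_neg hq hm h1)
    exact absurd hE0 (not_le.2 this)

lemma le_peak (h : IsPositiveSolution p q m u) (hp : 1 < p) (hq : 0 < q + 1) (hm : q < m)
    {r : ℝ} (hr : 0 < r) : u r ≤ peak q m := by
  by_contra! hlt
  have h1 := h.energy hp hq (by linarith) r hr
  have h2 := potential_neg hq hm hlt
  have h3 : 0 ≤ |deriv u r| ^ p := by positivity
  have hc : 0 < p / (p - 1) := div_pos (by linarith) (by linarith)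
  nlinarith

/-- If u returned to the peak at some r > 0, then u would equal the peak on all of (0, r): a lower
interior minimum would have u' = 0 where the potential is positive. But a constant solution must
satisfy s^m = s^q, and the peak exceeds 1. -/
lemma lt_peak (h : IsPositiveSolution p q m u) (hp : 1 < p) (hq : 0 < q + 1) (hm : q < m)
    {r : ℝ} (hr : 0 < r) : u r < peak q m := by
  refine lt_of_le_of_ne (h.le_peak hp hq hm hr) fun heq => ?_
  have hc : 0 < p / (p - 1) := div_pos (by linarith) (by linarith)
  obtain ⟨c, hc1, hc2⟩ := isCompact_Icc.exists_isMinOn (nonempty_Icc.2 hr.le)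
    (h.continuousOn.mono (fun x hx => hx.1))
  have hcpeak : peak q m ≤ u c := by
    by_contra! hlt
    have hc0 : 0 < c := lt_of_le_of_ne hc1.1 (by
      rintro rfl; rw [h.apply_zero hp hq hm] at hlt; exact lt_irrefl _ hlt)
    have hcr : c < r := lt_of_le_of_ne hc1.2 (by
      rintro rfl; rw [heq] at hlt; exact lt_irrefl _ hlt)
    have hloc : IsLocalMin u c := hc2.isLocalMin (Icc_mem_nhds hc0 hcr)
    have h1 := h.energy hp hq (by linarith) c hc0
    rw [hloc.deriv_eq_zero, abs_zero, Real.zero_rpow (by linarith)] at h1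
    have h2 := mul_pos hc ((potential_pos_iff hq hm (h.pos c hc0.le)).2 hlt)
    linarith
  have hconst : ∀ s ∈ Ioo 0 r, u s = peak q m := fun s hs =>
    le_antisymm (h.le_peak hp hq hm hs.1) (hcpeak.trans (hc2 (Ioo_subset_Icc_self hs)))
  have hder : ∀ s ∈ Ioo 0 r, deriv u s = 0 := by
    intro s hs
    have : u =ᶠ[𝓝 s] fun _ => peak q m := by
      filter_upwards [Ioo_mem_nhds hs.1 hs.2] with t ht using hconst t ht
    rw [this.deriv_eq]; simp
  have hmid : r / 2 ∈ Ioo 0 r := ⟨by linarith, by linarith⟩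
  have hflux : deriv (fun s => |deriv u s| ^ (p - 2) * deriv u s) (r / 2) = 0 := by
    have : (fun s => |deriv u s| ^ (p - 2) * deriv u s) =ᶠ[𝓝 (r / 2)] fun _ => 0 := by
      filter_upwards [Ioo_mem_nhds hmid.1 hmid.2] with t ht
      rw [hder t ht, mul_zero]
    rw [this.deriv_eq]; simp
  have h1 := h.equation (r / 2) hmid.1
  rw [hflux, hconst _ hmid, zero_add] at h1
  have := Real.rpow_lt_rpow_of_exponent_lt (one_lt_peak hq hm) hm
  linarith

/-- By the first integral u' never vanishes for r > 0, so it has a fixed sign by Darboux. A positive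
sign would push u above u(0), its upper bound. -/
lemma deriv_neg (h : IsPositiveSolution p q m u) (hp : 1 < p) (hq : 0 < q + 1) (hm : q < m) :
    ∀ r, 0 < r → deriv u r < 0 := by
  have hc : 0 < p / (p - 1) := div_pos (by linarith) (by linarith)
  have hne : ∀ r ∈ Ioi (0 : ℝ), deriv u r ≠ 0 := by
    intro r hr h0
    have h1 := h.energy hp hq (by linarith) r hr
    rw [h0, abs_zero, Real.zero_rpow (by linarith)] at h1
    have := mul_pos hc ((potential_pos_iff hq hm (h.pos r (le_of_lt hr))).2
      (h.lt_peak hp hq hm hr))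
    linarith
  rcases hasDerivWithinAt_forall_lt_or_forall_gt_of_forall_ne (convex_Ioi 0)
    (fun x hx => (h.differentiableAt x hx).hasDerivAt.hasDerivWithinAt) hne with h1 | h1
  · exact h1
  · exfalso
    have hmono : StrictMonoOn u (Ici 0) := strictMonoOn_of_deriv_pos (convex_Ici 0) h.continuousOn
      (by rwa [interior_Ici])
    have h2 := hmono (show (0 : ℝ) ∈ Ici 0 by simp) (show (1 : ℝ) ∈ Ici 0 by simp) one_pos
    rw [h.apply_zero hp hq hm] at h2
    exact lt_asymm h2 (h.lt_peak hp hq hm one_pos)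

/-- The profile solves an autonomous first order equation. -/
lemma deriv_eq (h : IsPositiveSolution p q m u) (hp : 1 < p) (hq : 0 < q + 1) (hm : q < m)
    {r : ℝ} (hr : 0 < r) : deriv u r = -(p / (p - 1) * potential q m (u r)) ^ (1 / p) := by
  rw [← h.energy hp hq (by linarith) r hr, ← Real.rpow_mul (abs_nonneg _),
    mul_one_div_cancel (by linarith), Real.rpow_one, abs_of_neg (h.deriv_neg hp hq hm r hr),
    neg_neg]

end IsPositiveSolution

end GNOneDim

/-! ### The incomplete Beta function and its inverse -/

namespace GNOneDim

section IncompleteBeta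

variable {a b : ℝ}

lemma intervalIntegrable_incBeta (ha : 0 < a) {x y : ℝ} (hx : x ∈ Ico (0 : ℝ) 1)
    (hy : y ∈ Ico (0 : ℝ) 1) :
    IntervalIntegrable (fun t : ℝ => t ^ (a - 1) * (1 - t) ^ (b - 1)) volume x y := by
  refine (intervalIntegral.intervalIntegrable_rpow' (by linarith)).mul_continuousOn ?_
  intro t ht
  have ht1 : t < 1 := lt_of_le_of_lt ht.2 (max_lt hx.2 hy.2)
  exact ((continuousAt_const.sub continuousAt_id).rpow_const
    (Or.inl (sub_pos.2 ht1).ne')).continuousWithinAt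

lemma incBeta_zero : incBeta 0 a b = 0 := by simp [incBeta]

lemma hasDerivAt_incBeta (ha : 0 < a) {x : ℝ} (hx : x ∈ Ioo (0 : ℝ) 1) :
    HasDerivAt (fun x => incBeta x a b) (x ^ (a - 1) * (1 - x) ^ (b - 1)) x := by
  refine intervalIntegral.integral_hasDerivAt_right (intervalIntegrable_incBeta ha (by simp)
    ⟨hx.1.le, hx.2⟩) ?_ ?_
  · refine ContinuousOn.stronglyMeasurableAtFilter isOpen_Ioo ?_ x hx
    intro t ht
    exact ((continuousAt_id.rpow_const (Or.inl ht.1.ne')).mul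
      ((continuousAt_const.sub continuousAt_id).rpow_const
      (Or.inl (sub_pos.2 ht.2).ne'))).continuousWithinAt
  · exact (continuousAt_id.rpow_const (Or.inl hx.1.ne')).mul
      ((continuousAt_const.sub continuousAt_id).rpow_const
      (Or.inl (sub_pos.2 hx.2).ne'))

lemma continuousOn_incBeta (ha : 0 < a) : ContinuousOn (fun x => incBeta x a b) (Ico 0 1) := by
  intro x hx
  obtain ⟨y, hxy, hy1⟩ := exists_between hx.2
  have hy0 : 0 < y := lt_of_le_of_lt hx.1 hxy
  have h := intervalIntegral.continuousOn_primitive_interval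
    ((intervalIntegrable_iff_integrableOn_Icc_of_le hy0.le).1
      (intervalIntegrable_incBeta (b := b) ha (x := 0) (y := y) (by simp) ⟨hy0.le, hy1⟩) |>.mono_set
        (by rw [uIcc_of_le hy0.le]))
  rw [uIcc_of_le hy0.le] at h
  refine (h x ⟨hx.1, hxy.le⟩).mono_of_mem_nhdsWithin ?_
  rw [mem_nhdsWithin]
  exact ⟨Iio y, isOpen_Iio, hxy, fun z hz => ⟨hz.2.1, hz.1.le⟩⟩

lemma strictMonoOn_incBeta (ha : 0 < a) : StrictMonoOn (fun x => incBeta x a b) (Ico 0 1) := by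
  refine strictMonoOn_of_deriv_pos (convex_Ico 0 1) (continuousOn_incBeta ha) fun x hx => ?_
  rw [interior_Ico] at hx
  rw [(hasDerivAt_incBeta ha hx).deriv]
  exact mul_pos (Real.rpow_pos_of_pos hx.1 _) (Real.rpow_pos_of_pos (by linarith [hx.2]) _)

/-- For a ≤ 1 and b ≤ 0 the integrand dominates 1/(1-t). This gives the divergence at 1, hence
surjectivity onto the half-line. -/
lemma neg_log_le_incBeta (ha : 0 < a) (ha1 : a ≤ 1) (hb : b ≤ 0) {x : ℝ}
    (hx : x ∈ Ico (0 : ℝ) 1) : -Real.log (1 - x) ≤ incBeta x a b := by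
  have hmono : MonotoneOn (fun x => incBeta x a b + Real.log (1 - x)) (Ico 0 1) := by
    have hd : ∀ y ∈ Ioo (0 : ℝ) 1, HasDerivAt (fun x => incBeta x a b + Real.log (1 - x))
        (y ^ (a - 1) * (1 - y) ^ (b - 1) + -1 / (1 - y)) y := fun y hy =>
      (hasDerivAt_incBeta ha hy).add
        (((hasDerivAt_id y).const_sub 1).log (sub_pos.2 hy.2).ne')
    refine monotoneOn_of_deriv_nonneg (convex_Ico 0 1) ?_ ?_ ?_
    · refine (continuousOn_incBeta ha).add fun y hy => ?_
      exact ((continuousAt_const.sub continuousAt_id).log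
        (sub_pos.2 hy.2).ne').continuousWithinAt
    · rw [interior_Ico]
      exact fun y hy => (hd y hy).differentiableAt.differentiableWithinAt
    · rw [interior_Ico]
      intro y hy
      rw [(hd y hy).deriv]
      have hy1 : 0 < 1 - y := by linarith [hy.2]
      have h1 : 1 ≤ y ^ (a - 1) :=
        Real.one_le_rpow_of_pos_of_le_one_of_nonpos hy.1 hy.2.le (by linarith)
      have h2 : (1 - y)⁻¹ ≤ (1 - y) ^ (b - 1) := by
        rw [← Real.rpow_neg_one]
        exact Real.rpow_le_rpow_of_exponent_ge hy1 (by linarith [hy.1]) (by linarith)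
      have h3 : 0 < (1 - y)⁻¹ := by positivity
      rw [neg_div, one_div]
      nlinarith
  have := hmono (show (0 : ℝ) ∈ Ico 0 1 by simp) hx hx.1
  simp only [incBeta_zero, sub_zero, Real.log_one, add_zero] at this
  linarith

lemma bijOn_incBeta (ha : 0 < a) (ha1 : a ≤ 1) (hb : b ≤ 0) :
    BijOn (fun x => incBeta x a b) (Ico 0 1) (Ici 0) := by
  refine ⟨fun x hx => ?_, (strictMonoOn_incBeta ha).injOn, fun y hy => ?_⟩
  · have := (strictMonoOn_incBeta (b := b) ha).monotoneOn (show (0 : ℝ) ∈ Ico 0 1 by simp) hx hx.1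
    simpa [incBeta_zero] using this
  · have hy0 : (0 : ℝ) ≤ y := hy
    -- Chosen so that -log(1-z) = y; the logarithmic lower bound then puts y below the value at z.
    set z := 1 - Real.exp (-y) with hz
    have hz0 : 0 ≤ z := by
      rw [hz, sub_nonneg, Real.exp_le_one_iff]; linarith
    have hz1 : z < 1 := by rw [hz]; linarith [Real.exp_pos (-y)]
    have h1 : y ≤ incBeta z a b := by
      have := neg_log_le_incBeta ha ha1 hb ⟨hz0, hz1⟩
      rw [hz, sub_sub_cancel, Real.log_exp, neg_neg, ← hz] at this
      exact this
    obtain ⟨x, hx, hx'⟩ := intermediate_value_Icc hz0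
      ((continuousOn_incBeta (b := b) ha).mono (fun t ht => ⟨ht.1, ht.2.trans_lt hz1⟩))
      (show y ∈ Icc (incBeta 0 a b) (incBeta z a b) from ⟨by rw [incBeta_zero]; exact hy0, h1⟩)
    exact ⟨x, ⟨hx.1, hx.2.trans_lt hz1⟩, hx'⟩

lemma invOn_incBetaInv (ha : 0 < a) (ha1 : a ≤ 1) (hb : b ≤ 0) :
    InvOn (fun y => incBetaInv y a b) (fun x => incBeta x a b) (Ico 0 1) (Ici 0) :=
  (bijOn_incBeta ha ha1 hb).invOn_invFunOn

lemma incBetaInv_mem (ha : 0 < a) (ha1 : a ≤ 1) (hb : b ≤ 0) {y : ℝ} (hy : 0 ≤ y) :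
    incBetaInv y a b ∈ Ico (0 : ℝ) 1 :=
  (bijOn_incBeta ha ha1 hb).surjOn.mapsTo_invFunOn hy

lemma incBeta_incBetaInv (ha : 0 < a) (ha1 : a ≤ 1) (hb : b ≤ 0) {y : ℝ} (hy : 0 ≤ y) :
    incBeta (incBetaInv y a b) a b = y :=
  (invOn_incBetaInv ha ha1 hb).2 hy

lemma incBetaInv_incBeta (ha : 0 < a) (ha1 : a ≤ 1) (hb : b ≤ 0) {x : ℝ}
    (hx : x ∈ Ico (0 : ℝ) 1) : incBetaInv (incBeta x a b) a b = x :=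
  (invOn_incBetaInv ha ha1 hb).1 hx

lemma incBetaInv_zero (ha : 0 < a) (ha1 : a ≤ 1) (hb : b ≤ 0) : incBetaInv 0 a b = 0 := by
  have := incBetaInv_incBeta (b := b) ha ha1 hb (show (0 : ℝ) ∈ Ico 0 1 by simp)
  rwa [incBeta_zero] at this

lemma strictMonoOn_incBetaInv (ha : 0 < a) (ha1 : a ≤ 1) (hb : b ≤ 0) :
    StrictMonoOn (fun y => incBetaInv y a b) (Ici 0) := by
  intro x hx y hy hxy
  refine ((strictMonoOn_incBeta (b := b) ha).lt_iff_lt (incBetaInv_mem ha ha1 hb hx)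
    (incBetaInv_mem ha ha1 hb hy)).1 ?_
  simpa only [incBeta_incBetaInv ha ha1 hb hx, incBeta_incBetaInv ha ha1 hb hy] using hxy

lemma image_incBetaInv (ha : 0 < a) (ha1 : a ≤ 1) (hb : b ≤ 0) :
    (fun y => incBetaInv y a b) '' Ici 0 = Ico 0 1 := by
  ext x
  constructor
  · rintro ⟨y, hy, rfl⟩; exact incBetaInv_mem ha ha1 hb hy
  · intro hx
    exact ⟨incBeta x a b, (bijOn_incBeta ha ha1 hb).mapsTo hx, incBetaInv_incBeta ha ha1 hb hx⟩

lemma incBetaInv_pos (ha : 0 < a) (ha1 : a ≤ 1) (hb : b ≤ 0) {y : ℝ} (hy : 0 < y) :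
    0 < incBetaInv y a b := by
  have := strictMonoOn_incBetaInv (b := b) ha ha1 hb (show (0 : ℝ) ∈ Ici 0 by simp)
    (mem_Ici.2 hy.le) hy
  simpa only [incBetaInv_zero ha ha1 hb] using this

lemma continuousAt_incBetaInv (ha : 0 < a) (ha1 : a ≤ 1) (hb : b ≤ 0) {y : ℝ} (hy : 0 < y) :
    ContinuousAt (fun y => incBetaInv y a b) y := by
  refine (strictMonoOn_incBetaInv ha ha1 hb).continuousAt_of_image_mem_nhds (Ici_mem_nhds hy) ?_
  rw [image_incBetaInv ha ha1 hb]
  exact Ico_mem_nhds (incBetaInv_pos ha ha1 hb hy) (incBetaInv_mem ha ha1 hb hy.le).2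

lemma continuousWithinAt_incBetaInv_zero (ha : 0 < a) (ha1 : a ≤ 1) (hb : b ≤ 0) :
    ContinuousWithinAt (fun y => incBetaInv y a b) (Ici 0) 0 := by
  refine (strictMonoOn_incBetaInv ha ha1 hb).continuousWithinAt_right_of_image_mem_nhdsWithin
    self_mem_nhdsWithin ?_
  rw [image_incBetaInv ha ha1 hb, incBetaInv_zero ha ha1 hb]
  exact Ico_mem_nhdsGE one_pos

lemma hasDerivAt_incBetaInv (ha : 0 < a) (ha1 : a ≤ 1) (hb : b ≤ 0) {y : ℝ} (hy : 0 < y) :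
    HasDerivAt (fun y => incBetaInv y a b)
      (incBetaInv y a b ^ (a - 1) * (1 - incBetaInv y a b) ^ (b - 1))⁻¹ y := by
  have h0 := incBetaInv_pos (b := b) ha ha1 hb hy
  have h1 := (incBetaInv_mem (b := b) ha ha1 hb hy.le).2
  refine HasDerivAt.of_local_left_inverse (continuousAt_incBetaInv ha ha1 hb hy)
    (hasDerivAt_incBeta ha ⟨h0, h1⟩) ?_ ?_
  · exact (mul_pos (Real.rpow_pos_of_pos h0 _) (Real.rpow_pos_of_pos (by linarith) _)).ne'
  · filter_upwards [Ioi_mem_nhds hy] with z hz using incBeta_incBetaInv ha ha1 hb (le_of_lt hz)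

lemma tendsto_incBetaInv (ha : 0 < a) (ha1 : a ≤ 1) (hb : b ≤ 0) :
    Tendsto (fun y => incBetaInv y a b) atTop (𝓝 1) := by
  rw [tendsto_order]
  refine ⟨fun c hc => ?_, fun c hc => ?_⟩
  · have hmem : max c 0 ∈ Ico (0 : ℝ) 1 := ⟨le_max_right _ _, max_lt hc one_pos⟩
    filter_upwards [eventually_gt_atTop (incBeta (max c 0) a b), eventually_ge_atTop 0] with y hy hy0
    have := strictMonoOn_incBetaInv (b := b) ha ha1 hb
      ((bijOn_incBeta ha ha1 hb).mapsTo hmem) (mem_Ici.2 hy0) hy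
    simp only [incBetaInv_incBeta ha ha1 hb hmem] at this
    exact (le_max_left _ _).trans_lt this
  · filter_upwards [eventually_ge_atTop 0] with y hy
    exact (incBetaInv_mem ha ha1 hb hy).2.trans hc

end IncompleteBeta

end GNOneDim

/-! ### The closed form -/

namespace GNOneDim

/-- The constant `κ` in `-u' = κ u^((q+1)/p) (1 - (u/u(0))^(m-q))^(1/p)`. -/
noncomputable def kappa (p q : ℝ) : ℝ := (p / (p - 1) / (q + 1)) ^ (1 / p)

variable {p q m : ℝ}

lemma kappa_pos (hp : 1 < p) (hq : 0 < q + 1) : 0 < kappa p q :=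
  Real.rpow_pos_of_pos (div_pos (div_pos (by linarith) (by linarith)) hq) _

lemma speed_eq (hp : 1 < p) (hq : 0 < q + 1) (hm : q < m) {s : ℝ} (hs : 0 < s)
    (hs1 : s < peak q m) : (p / (p - 1) * potential q m s) ^ (1 / p) =
      kappa p q * s ^ ((q + 1) / p) * (1 - (s / peak q m) ^ (m - q)) ^ (1 / p) := by
  have hX : 0 < 1 - (s / peak q m) ^ (m - q) :=
    sub_pos.2 ((div_peak_rpow_lt_one_iff hq hm hs).2 hs1)
  have hP : 0 < p / (p - 1) := div_pos (by linarith) (by linarith)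
  have hsq := Real.rpow_pos_of_pos hs (q + 1)
  rw [potential_eq hq hm hs, kappa,
    show p / (p - 1) * (s ^ (q + 1) / (q + 1) * (1 - (s / peak q m) ^ (m - q))) =
      p / (p - 1) / (q + 1) * s ^ (q + 1) * (1 - (s / peak q m) ^ (m - q)) by ring,
    Real.mul_rpow (by positivity) hX.le, Real.mul_rpow (by positivity) (by positivity),
    ← Real.rpow_mul hs.le, mul_one_div]

/-- The form in which the constant comes out of the equation: m-q from differentiating the power,
`kappa` from the speed, and the remaining power of the peak from rescaling u by u(0). -/
lemma Cbar_eq (hp : 1 < p) (hq : 0 < q + 1) (hm : q < m) :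
    Cbar p q m = (m - q) * kappa p q * peak q m ^ ((q + 1 - p) / p) := by
  have hm1 : 0 < m + 1 := by linarith
  have hP : 0 < p / (p - 1) := div_pos (by linarith) (by linarith)
  have hmq : m - q ≠ 0 := by linarith
  have hp0 : p ≠ 0 := by linarith
  rw [Cbar, kappa, peak, ← Real.rpow_mul (by positivity), Real.div_rpow hP.le hq.le,
    Real.div_rpow hm1.le hq.le]
  have h1 : (p - m - 1) / (p * (m - q)) = -(1 / p) - 1 / (m - q) * ((q + 1 - p) / p) := by
    field_simp; ring
  have h2 : (1 + q - p) / (p * (m - q)) = 1 / (m - q) * ((q + 1 - p) / p) := by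
    field_simp; ring
  rw [h1, h2, Real.rpow_sub hq, Real.rpow_neg hq.le]
  ring

lemma Cbar_pos (hp : 1 < p) (hq : 0 < q + 1) (hm : q < m) : 0 < Cbar p q m := by
  rw [Cbar_eq hp hq hm]
  exact mul_pos (mul_pos (by linarith) (kappa_pos hp hq)) (Real.rpow_pos_of_pos (peak_pos hq hm) _)

/-- The incomplete Beta integrand turns the profile equation into `B(X)' = C̄`. -/
lemma integrand_mul_rate (hp : 1 < p) (hq : 0 < q + 1) (hm : q < m) {s : ℝ} (hs : 0 < s)
    (hs1 : s < peak q m) :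
    (1 - (s / peak q m) ^ (m - q)) ^ (1 - 1 / p - 1) *
        (1 - (1 - (s / peak q m) ^ (m - q))) ^ ((p - 1 - q) / (p * (m - q)) - 1) *
      ((m - q) * (s / peak q m) ^ (m - q) / s * (p / (p - 1) * potential q m s) ^ (1 / p)) =
    Cbar p q m := by
  have hX : 0 < 1 - (s / peak q m) ^ (m - q) :=
    sub_pos.2 ((div_peak_rpow_lt_one_iff hq hm hs).2 hs1)
  have hpk := peak_pos hq hm
  have hmq : m - q ≠ 0 := by linarith
  have hp0 : p ≠ 0 := by linarith
  have hsp : 0 < s / peak q m := by positivity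
  have hY : 0 < (s / peak q m) ^ (m - q) := Real.rpow_pos_of_pos hsp _
  rw [speed_eq hp hq hm hs hs1, Cbar_eq hp hq hm, sub_sub_cancel, Real.rpow_sub_one hY.ne',
    ← Real.rpow_mul hsp.le,
    show (m - q) * ((p - 1 - q) / (p * (m - q))) = -((q + 1 - p) / p) by field_simp; ring,
    Real.rpow_neg hsp.le, Real.div_rpow hs.le hpk.le ((q + 1 - p) / p),
    show 1 - 1 / p - 1 = -(1 / p) by ring, Real.rpow_neg hX.le,
    show (q + 1 - p) / p = (q + 1) / p - 1 by field_simp, Real.rpow_sub_one hs.ne']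
  have h1 := (Real.rpow_pos_of_pos hX (1 / p)).ne'
  have h2 := (Real.rpow_pos_of_pos hs ((q + 1) / p)).ne'
  have h3 := (Real.rpow_pos_of_pos hpk ((q + 1) / p - 1)).ne'
  field_simp

lemma beta_exponents (hp : 1 < p) (hq : p - 1 ≤ q) (hm : q < m) :
    0 < 1 - 1 / p ∧ 1 - 1 / p ≤ 1 ∧ (p - 1 - q) / (p * (m - q)) ≤ 0 := by
  refine ⟨?_, ?_, ?_⟩
  · rw [sub_pos, div_lt_one (by linarith)]; exact hp
  · have : 0 < 1 / p := by positivity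
    linarith
  · exact div_nonpos_of_nonpos_of_nonneg (by linarith)
      (mul_nonneg (by linarith) (by linarith))

/-- By `integrand_mul_rate`, incBeta(X(r)) - C̄ r has zero derivative for r > 0, and it vanishes at
r = 0 because u(0) is the peak. Inverting the Beta function and then the power recovers u. -/
lemma IsPositiveSolution.eq_closedForm {u : ℝ → ℝ} (h : IsPositiveSolution p q m u) (hp : 1 < p)
    (hqp : p - 1 ≤ q) (hm : q < m) {r : ℝ} (hr : 0 ≤ r) : u r = closedForm p q m r := by
  have hq : 0 < q + 1 := by linarith
  have hpk := peak_pos hq hm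
  have hmq : m - q ≠ 0 := by linarith
  obtain ⟨ha, ha1, hb⟩ := beta_exponents hp hqp hm
  set a := 1 - 1 / p with ha_def
  set b := (p - 1 - q) / (p * (m - q)) with hb_def
  set X : ℝ → ℝ := fun s => 1 - (u s / peak q m) ^ (m - q) with hX
  have hupos : ∀ s, 0 ≤ s → 0 < u s / peak q m := fun s hs => div_pos (h.pos s hs) hpk
  have hX0 : X 0 = 0 := by
    simp only [hX]; rw [h.apply_zero hp hq hm, div_self hpk.ne', Real.one_rpow, sub_self]
  have hX1 : ∀ s, 0 ≤ s → X s < 1 := fun s hs => by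
    have := Real.rpow_pos_of_pos (hupos s hs) (m - q)
    simp only [hX]; linarith
  have hXpos : ∀ s, 0 < s → 0 < X s := fun s hs =>
    sub_pos.2 ((div_peak_rpow_lt_one_iff hq hm (h.pos s hs.le)).2 (h.lt_peak hp hq hm hs))
  have hXmem : ∀ s, 0 ≤ s → X s ∈ Ico (0 : ℝ) 1 := fun s hs => by
    refine ⟨?_, hX1 s hs⟩
    rcases hs.eq_or_lt with h0 | h0
    · rw [← h0, hX0]
    · exact (hXpos s h0).le
  have hXcont : ContinuousOn X (Ici 0) := by
    refine continuousOn_const.sub ?_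
    exact (h.continuousOn.div_const _).rpow_const (fun s hs => Or.inl (hupos s hs).ne')
  have hXd : ∀ s, 0 < s → HasDerivAt X ((m - q) * (u s / peak q m) ^ (m - q) / u s *
      (p / (p - 1) * potential q m (u s)) ^ (1 / p)) s := by
    intro s hs
    have h1 := (((h.differentiableAt s hs).hasDerivAt.div_const (peak q m)).rpow_const
      (p := m - q) (Or.inl (hupos s hs.le).ne')).const_sub 1
    refine h1.congr_deriv ?_
    rw [h.deriv_eq hp hq hm hs, Real.rpow_sub_one (hupos s hs.le).ne']
    have := (h.pos s hs.le).ne'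
    field_simp
  have hconst : ∀ s, 0 < s →
      HasDerivAt (fun s => incBeta (X s) a b - Cbar p q m * s) 0 s := by
    intro s hs
    have h1 := (hasDerivAt_incBeta (b := b) ha ⟨hXpos s hs, hX1 s hs.le⟩).comp s (hXd s hs)
    have h2 := (hasDerivAt_id s).const_mul (Cbar p q m)
    refine (h1.sub h2).congr_deriv ?_
    simp only [hX, ha_def, hb_def]
    rw [integrand_mul_rate hp hq hm (h.pos s hs.le) (h.lt_peak hp hq hm hs), mul_one, sub_self]
  have hcont : ContinuousOn (fun s => incBeta (X s) a b - Cbar p q m * s) (Ici 0) :=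
    ((continuousOn_incBeta ha).comp hXcont hXmem).sub (continuousOn_const.mul continuousOn_id)
  -- The derivative is known only inside the half-line, with continuity up to 0. Being both monotone
  -- and antitone, the function is constant on the closed half-line.
  have hmono := monotoneOn_of_deriv_nonneg (convex_Ici 0) hcont
    (by rw [interior_Ici]; exact fun s hs => (hconst s hs).differentiableAt.differentiableWithinAt)
    (by rw [interior_Ici]; exact fun s hs => (hconst s hs).deriv.ge)
  have hanti := antitoneOn_of_deriv_nonpos (convex_Ici 0) hcont
    (by rw [interior_Ici]; exact fun s hs => (hconst s hs).differentiableAt.differentiableWithinAt)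
    (by rw [interior_Ici]; exact fun s hs => (hconst s hs).deriv.le)
  have h0 : (0 : ℝ) ∈ Ici (0 : ℝ) := by simp
  have hle := hmono h0 (mem_Ici.2 hr) hr
  have hge := hanti h0 (mem_Ici.2 hr) hr
  simp only [hX0, incBeta_zero, mul_zero, sub_zero] at hle hge
  have hval : incBeta (X r) a b = Cbar p q m * r := by linarith
  rw [closedForm, ← hval, incBetaInv_incBeta ha ha1 hb (hXmem r hr)]
  simp only [hX, sub_sub_cancel]
  rw [← Real.rpow_mul (hupos r hr).le, mul_one_div_cancel hmq, Real.rpow_one]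
  change u r = peak q m * _
  field_simp

/-- Converse passage from first to second order. The flux is -(p/(p-1) F(u))^((p-1)/p), a power of a
positive differentiable quantity, so it can be differentiated by the chain rule. At 0, u' tends to 0
because the potential vanishes at the peak, and this limit is the one-sided derivative. -/
lemma isPositiveSolution_of_hasDerivAt {u : ℝ → ℝ} (hp : 1 < p) (hq : 0 < q + 1) (hm : q < m)
    (hpos : ∀ r, 0 ≤ r → 0 < u r) (hlt : ∀ r, 0 < r → u r < peak q m) (h0 : u 0 = peak q m)
    (hcont : ContinuousWithinAt u (Ici 0) 0)
    (hd : ∀ r, 0 < r → HasDerivAt u (-(p / (p - 1) * potential q m (u r)) ^ (1 / p)) r)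
    (hlim : Tendsto u atTop (𝓝 0)) : IsPositiveSolution p q m u := by
  have hm1 : 0 < m + 1 := by linarith
  have hP : 0 < p / (p - 1) := div_pos (by linarith) (by linarith)
  have hp0 : p ≠ 0 := by linarith
  have hFpos : ∀ r, 0 < r → 0 < p / (p - 1) * potential q m (u r) := fun r hr =>
    mul_pos hP ((potential_pos_iff hq hm (hpos r hr.le)).2 (hlt r hr))
  have hflux : ∀ r, 0 < r → HasDerivAt (fun s => |deriv u s| ^ (p - 2) * deriv u s)
      (u r ^ q - u r ^ m) r := by
    intro r hr
    have h1 := (((hasDerivAt_potential (q := q) (m := m) hq.ne' hm1.ne' (hpos r hr.le)).comp r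
      (hd r hr)).const_mul (p / (p - 1))).rpow_const (p := (p - 1) / p)
      (Or.inl (hFpos r hr).ne')
    refine (h1.neg.congr_deriv ?_).congr_of_eventuallyEq ?_
    · simp only [Function.comp_apply]
      rw [show (p - 1) / p - 1 = -(1 / p) by field_simp; ring, Real.rpow_neg (hFpos r hr).le]
      have h2 := (Real.rpow_pos_of_pos (hFpos r hr) (1 / p)).ne'
      have h3 : p - 1 ≠ 0 := by linarith
      generalize (p / (p - 1) * potential q m (u r)) ^ (1 / p) = S at h2 ⊢
      field_simp
    · filter_upwards [Ioi_mem_nhds hr] with s hs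
      have h2 := hFpos s hs
      have h3 := Real.rpow_pos_of_pos h2 (1 / p)
      rw [(hd s hs).deriv, abs_neg, abs_of_pos h3]
      simp only [Pi.neg_apply, Function.comp_apply]
      rw [mul_neg, ← Real.rpow_add_one h3.ne', ← Real.rpow_mul h2.le]
      congr 2
      ring
  refine ⟨hpos, fun r hr => (hd r hr).differentiableAt, fun r hr => (hflux r hr).differentiableAt,
    fun r hr => ?_, ?_, hlim⟩
  · rw [(hflux r hr).deriv]; ring
  · refine hasDerivWithinAt_Ici_of_tendsto_deriv (s := Ioi 0)
      (fun r hr => (hd r hr).differentiableAt.differentiableWithinAt)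
      (hcont.mono Ioi_subset_Ici_self) self_mem_nhdsWithin ?_
    have h1 : Tendsto (fun r => -(p / (p - 1) * potential q m (u r)) ^ (1 / p)) (𝓝[>] 0)
        (𝓝 (-(p / (p - 1) * potential q m (u 0)) ^ (1 / p))) := by
      have hF : Continuous fun s => -(p / (p - 1) * potential q m s) ^ (1 / p) :=
        ((Real.continuous_rpow_const (by positivity)).comp
          ((continuous_potential hq hm1).const_mul _)).neg
      exact hF.continuousAt.tendsto.comp (hcont.mono Ioi_subset_Ici_self)
    rw [h0, potential_peak hq hm, mul_zero, Real.zero_rpow (by positivity), neg_zero] at h1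
    refine h1.congr' ?_
    filter_upwards [self_mem_nhdsWithin] with r hr using (hd r hr).deriv.symm

lemma isPositiveSolution_closedForm (hp : 1 < p) (hqp : p - 1 ≤ q) (hm : q < m) :
    IsPositiveSolution p q m (closedForm p q m) := by
  have hq : 0 < q + 1 := by linarith
  have hpk := peak_pos hq hm
  have hmq : 0 < m - q := by linarith
  have hC := Cbar_pos hp hq hm
  obtain ⟨ha, ha1, hb⟩ := beta_exponents hp hqp hm
  set a := 1 - 1 / p with ha_def
  set b := (p - 1 - q) / (p * (m - q)) with hb_def
  set X : ℝ → ℝ := fun r => incBetaInv (Cbar p q m * r) a b with hX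
  have hform : closedForm p q m = fun r => peak q m * (1 - X r) ^ (1 / (m - q)) := rfl
  have hXmem : ∀ r, 0 ≤ r → X r ∈ Ico (0 : ℝ) 1 := fun r hr =>
    incBetaInv_mem ha ha1 hb (by positivity)
  have hXpos : ∀ r, 0 < r → 0 < X r := fun r hr => incBetaInv_pos ha ha1 hb (by positivity)
  have hX0 : X 0 = 0 := by simp only [hX, mul_zero]; exact incBetaInv_zero ha ha1 hb
  have hYpos : ∀ r, 0 ≤ r → 0 < 1 - X r := fun r hr => sub_pos.2 (hXmem r hr).2
  have hpos : ∀ r, 0 ≤ r → 0 < closedForm p q m r := fun r hr =>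
    mul_pos hpk (Real.rpow_pos_of_pos (hYpos r hr) _)
  have hlt : ∀ r, 0 < r → closedForm p q m r < peak q m := by
    intro r hr
    rw [hform]
    have := Real.rpow_lt_one (hYpos r hr.le).le (by linarith [hXpos r hr])
      (show 0 < 1 / (m - q) by positivity)
    exact mul_lt_of_lt_one_right hpk this
  have hY : ∀ r, 0 ≤ r → (closedForm p q m r / peak q m) ^ (m - q) = 1 - X r := by
    intro r hr
    rw [hform]
    simp only
    rw [mul_div_cancel_left₀ _ hpk.ne', ← Real.rpow_mul (hYpos r hr).le,
      one_div_mul_cancel hmq.ne', Real.rpow_one]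
  refine isPositiveSolution_of_hasDerivAt hp hq hm hpos hlt ?_ ?_ ?_ ?_
  · rw [hform]; simp [hX0]
  · have h1 : ContinuousWithinAt X (Ici 0) 0 := by
      have h2 := continuousWithinAt_incBetaInv_zero (b := b) ha ha1 hb
      have h3 : ContinuousWithinAt (fun r => Cbar p q m * r) (Ici 0) 0 :=
        (continuous_const.mul continuous_id).continuousWithinAt
      refine ContinuousWithinAt.comp (t := Ici 0) (g := fun y => incBetaInv y a b) ?_ h3 ?_
      · simpa using h2
      · intro r hr; exact mul_nonneg hC.le hr
    rw [hform]
    exact continuousWithinAt_const.mul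
      ((continuousWithinAt_const.sub h1).rpow_const (Or.inl (hYpos 0 le_rfl).ne'))
  · intro r hr
    have hr' : 0 < Cbar p q m * r := by positivity
    have h1 : HasDerivAt X ((X r ^ (a - 1) * (1 - X r) ^ (b - 1))⁻¹ * (Cbar p q m * 1)) r := (hasDerivAt_incBetaInv (b := b) ha ha1 hb hr').comp r
      ((hasDerivAt_id r).const_mul (Cbar p q m))
    have h2 := ((h1.const_sub 1).rpow_const (p := 1 / (m - q))
      (Or.inl (hYpos r hr.le).ne')).const_mul (peak q m)
    rw [← hform] at h2
    refine h2.congr_deriv ?_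
    have h3 := integrand_mul_rate hp hq hm (hpos r hr.le) (hlt r hr)
    rw [hY r hr.le, sub_sub_cancel, ← ha_def, ← hb_def] at h3
    rw [Real.rpow_sub_one (hYpos r hr.le).ne' (1 / (m - q)), ← h3]
    have h4 := (Real.rpow_pos_of_pos (hXpos r hr) (a - 1)).ne'
    have h5 := (Real.rpow_pos_of_pos (hYpos r hr.le) (b - 1)).ne'
    have h6 : peak q m * (1 - X r) ^ (1 / (m - q)) = closedForm p q m r := rfl
    have h7 := (hpos r hr.le).ne'
    have h8 := (hYpos r hr.le).ne'
    have h9 : (1 - X r) ^ (1 / (m - q)) = closedForm p q m r / peak q m := by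
      rw [← h6, mul_div_cancel_left₀ _ hpk.ne']
    rw [h9]
    generalize (p / (p - 1) * potential q m (closedForm p q m r)) ^ (1 / p) = S
    generalize closedForm p q m r = U at *
    field_simp
  · have h1 : Tendsto X atTop (𝓝 1) :=
      (tendsto_incBetaInv ha ha1 hb).comp (tendsto_id.const_mul_atTop hC)
    have h2 := ((h1.const_sub 1).rpow_const (p := 1 / (m - q)) (Or.inr (by positivity))).const_mul
      (peak q m)
    rw [sub_self, Real.zero_rpow (by positivity), mul_zero] at h2
    exact h2

/-- The problem only sees u on [0, ∞), so a function agreeing there with the closed form inherits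
the first order equation, whatever its values on the negative axis. -/
lemma isPositiveSolution_iff (hp : 1 < p) (hqp : p - 1 ≤ q) (hm : q < m) (u : ℝ → ℝ) :
    IsPositiveSolution p q m u ↔ ∀ r : ℝ, 0 ≤ r → u r = closedForm p q m r := by
  refine ⟨fun h r hr => h.eq_closedForm hp hqp hm hr, fun h => ?_⟩
  have hq : 0 < q + 1 := by linarith
  have hc := isPositiveSolution_closedForm hp hqp hm
  have hev : ∀ r, 0 < r → u =ᶠ[𝓝 r] closedForm p q m := fun r hr => by
    filter_upwards [Ioi_mem_nhds hr] with s hs using h s (le_of_lt hs)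
  have heq : EqOn u (closedForm p q m) (Ici 0) := fun r hr => h r hr
  refine isPositiveSolution_of_hasDerivAt hp hq hm (fun r hr => h r hr ▸ hc.pos r hr)
    (fun r hr => h r hr.le ▸ hc.lt_peak hp hq hm hr) (h 0 le_rfl ▸ hc.apply_zero hp hq hm)
    (hc.deriv_zero.continuousWithinAt.congr heq (h 0 le_rfl)) (fun r hr => ?_)
    (hc.tendsto_zero.congr' ?_)
  · rw [h r hr.le, ← hc.deriv_eq hp hq hm hr]
    exact (hc.differentiableAt r hr).hasDerivAt.congr_of_eventuallyEq (hev r hr)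
  · filter_upwards [eventually_ge_atTop 0] with r hr using (h r hr).symm

end GNOneDim

/-! ### Decay uniform in m -/

namespace GNOneDim

/-- A radius beyond which every ground state with `m > 2q + 1` is at most `1`. -/
noncomputable def unitRadius (p q : ℝ) : ℝ := ((1 - 1 / p) * (kappa p q * ((q + 1) / 2)))⁻¹

lemma unitRadius_pos {p q : ℝ} (hp : 1 < p) (hq : 0 < q + 1) : 0 < unitRadius p q := by
  have h1 : 0 < 1 - 1 / p := by rw [sub_pos, div_lt_one (by linarith)]; exact hp
  have := kappa_pos hp hq
  unfold unitRadius
  positivity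

namespace IsPositiveSolution

variable {p q m : ℝ} {u : ℝ → ℝ}

lemma deriv_eq_speed (h : IsPositiveSolution p q m u) (hp : 1 < p) (hq : 0 < q + 1) (hm : q < m)
    {r : ℝ} (hr : 0 < r) : deriv u r =
      -(kappa p q * u r ^ ((q + 1) / p) * (1 - (u r / peak q m) ^ (m - q)) ^ (1 / p)) := by
  rw [h.deriv_eq hp hq hm hr, speed_eq hp hq hm (h.pos r hr.le) (h.lt_peak hp hq hm hr)]

lemma strictAntiOn (h : IsPositiveSolution p q m u) (hp : 1 < p) (hq : 0 < q + 1) (hm : q < m) :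
    StrictAntiOn u (Ici 0) :=
  strictAntiOn_of_deriv_neg (convex_Ici 0) h.continuousOn
    (by rw [interior_Ici]; exact h.deriv_neg hp hq hm)

lemma one_sub_pos (h : IsPositiveSolution p q m u) (hp : 1 < p) (hq : 0 < q + 1) (hm : q < m)
    {r : ℝ} (hr : 0 < r) : 0 < 1 - (u r / peak q m) ^ (m - q) :=
  sub_pos.2 ((div_peak_rpow_lt_one_iff hq hm (h.pos r hr.le)).2 (h.lt_peak hp hq hm hr))

/-- While u > 1, the quantity Z = (1 - (u/peak)^(m-q))^(1-1/p) grows at a rate bounded below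
independently of m. It starts at 0 and stays below 1, so this phase cannot last up to `unitRadius`.
-/
lemma le_one (h : IsPositiveSolution p q m u) (hp : 1 < p) (hqp : p - 1 ≤ q)
    (hm : 2 * q + 1 < m) {r : ℝ} (hr : unitRadius p q ≤ r) : u r ≤ 1 := by
  have hq : 0 < q + 1 := by linarith
  have hqm : q < m := by linarith
  have hmq : 0 < m - q := by linarith
  have hpk := peak_pos hq hqm
  have hk := kappa_pos hp hq
  have hr0 : 0 < r := (unitRadius_pos hp hq).trans_le hr
  have ha : 0 < 1 - 1 / p := by rw [sub_pos, div_lt_one (by linarith)]; exact hp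
  by_contra! hlt
  have hge : ∀ s ∈ Icc 0 r, 1 < u s := fun s hs =>
    hlt.trans_le ((h.strictAntiOn hp hq hqm).antitoneOn hs.1 (mem_Ici.2 hr0.le) hs.2)
  have hquo : ∀ s ∈ Icc 0 r, 0 < u s / peak q m := fun s hs => div_pos (h.pos s hs.1) hpk
  -- The exponent 1 - 1/p is the one for which differentiation cancels the factor (1 -
  -- (u/peak)^(m-q))^(1/p) of the speed, which degenerates at r = 0.
  set Z : ℝ → ℝ := fun s => (1 - (u s / peak q m) ^ (m - q)) ^ (1 - 1 / p) with hZ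
  have hd : ∀ s ∈ Ioo 0 r, HasDerivAt Z ((1 - 1 / p) * ((m - q) * (u s / peak q m) ^ (m - q) *
      kappa p q * u s ^ ((q + 1) / p - 1))) s := by
    intro s hs
    have hs' := Ioo_subset_Icc_self hs
    have hX := h.one_sub_pos hp hq hqm hs.1
    have h1 := ((((h.differentiableAt s hs.1).hasDerivAt.div_const (peak q m)).rpow_const
      (p := m - q) (Or.inl (hquo s hs').ne')).const_sub 1).rpow_const (p := 1 - 1 / p)
      (Or.inl hX.ne')
    refine h1.congr_deriv ?_
    rw [h.deriv_eq_speed hp hq hqm hs.1, Real.rpow_sub_one (hquo s hs').ne',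
      show 1 - 1 / p - 1 = -(1 / p) by ring, Real.rpow_neg hX.le,
      Real.rpow_sub_one (h.pos s hs.1.le).ne']
    have h2 := (Real.rpow_pos_of_pos hX (1 / p)).ne'
    have h3 := (h.pos s hs.1.le).ne'
    generalize (1 - (u s / peak q m) ^ (m - q)) ^ (1 / p) = W at h2 ⊢
    generalize 1 - 1 / p = a
    field_simp
  have hlow : ∀ s ∈ Ioo 0 r, (unitRadius p q)⁻¹ ≤ deriv Z s := by
    intro s hs
    have hs' := Ioo_subset_Icc_self hs
    rw [(hd s hs).deriv, unitRadius, inv_inv]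
    have h1 : (q + 1) / (m + 1) ≤ (u s / peak q m) ^ (m - q) := by
      rw [Real.div_rpow (h.pos s hs'.1).le hpk.le, peak_rpow hq hqm, ← one_div_div (m + 1)]
      have : 0 < (m + 1) / (q + 1) := div_pos (by linarith) hq
      gcongr
      exact Real.one_le_rpow (hge s hs').le hmq.le
    have h2 : 1 ≤ u s ^ ((q + 1) / p - 1) :=
      Real.one_le_rpow (hge s hs').le (by
        rw [sub_nonneg, one_le_div (by linarith)]; linarith)
    -- The assumption m > 2q+1 gives (m-q)/(m+1) ≥ 1/2, which removes m from the bound.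
    have h3 : (q + 1) / 2 ≤ (m - q) * (u s / peak q m) ^ (m - q) := by
      calc (q + 1) / 2 ≤ (m - q) * ((q + 1) / (m + 1)) := by
            rw [← mul_div_assoc, div_le_div_iff₀ two_pos (by linarith)]
            nlinarith
        _ ≤ _ := by gcongr
    refine mul_le_mul_of_nonneg_left ?_ ha.le
    calc kappa p q * ((q + 1) / 2) ≤ kappa p q * ((m - q) * (u s / peak q m) ^ (m - q)) := by
          gcongr
      _ = (m - q) * (u s / peak q m) ^ (m - q) * kappa p q * 1 := by ring
      _ ≤ _ := by
          have := (hquo s hs').le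
          gcongr
  have hcont : ContinuousOn Z (Icc 0 r) := by
    have h1 : ContinuousOn (fun s => 1 - (u s / peak q m) ^ (m - q)) (Icc 0 r) :=
      continuousOn_const.sub (((h.continuousOn.mono (fun x hx => hx.1)).div_const _).rpow_const
        (fun s hs => Or.inl (hquo s hs).ne'))
    exact h1.rpow_const (fun s _ => Or.inr ha.le)
  have hmv := (convex_Icc 0 r).mul_sub_le_image_sub_of_le_deriv hcont
    (by rw [interior_Icc]; exact fun s hs => (hd s hs).differentiableAt.differentiableWithinAt)
    (by rw [interior_Icc]; exact hlow) 0 ⟨le_rfl, hr0.le⟩ r ⟨hr0.le, le_rfl⟩ hr0.le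
  have hZ0 : Z 0 = 0 := by
    simp only [hZ]
    rw [h.apply_zero hp hq hqm, div_self hpk.ne', Real.one_rpow, sub_self, Real.zero_rpow ha.ne']
  have hZ1 : Z r < 1 := by
    refine Real.rpow_lt_one (h.one_sub_pos hp hq hqm hr0).le ?_ ha
    have := Real.rpow_pos_of_pos (hquo r ⟨hr0.le, le_rfl⟩) (m - q)
    linarith
  have h1 : 1 ≤ (unitRadius p q)⁻¹ * (r - 0) := by
    rw [sub_zero, inv_mul_eq_div, one_le_div (unitRadius_pos hp hq)]; exact hr
  linarith

/-- Once u ≤ 1, (u/peak)^(m-q) is at most (q+1)/(m+1) ≤ 1/2, so the last factor of the speed is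
bounded below independently of m. -/
lemma deriv_le (h : IsPositiveSolution p q m u) (hp : 1 < p) (hqp : p - 1 ≤ q)
    (hm : 2 * q + 1 < m) {r : ℝ} (hr : unitRadius p q ≤ r) :
    deriv u r ≤ -(kappa p q * (1 / 2) ^ (1 / p) * u r ^ ((q + 1) / p)) := by
  have hq : 0 < q + 1 := by linarith
  have hqm : q < m := by linarith
  have hpk := peak_pos hq hqm
  have hr0 : 0 < r := (unitRadius_pos hp hq).trans_le hr
  have hk := kappa_pos hp hq
  have hu := h.pos r hr0.le
  have hX : 1 / 2 ≤ 1 - (u r / peak q m) ^ (m - q) := by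
    have h1 : (u r / peak q m) ^ (m - q) ≤ 1 / 2 := by
      rw [Real.div_rpow hu.le hpk.le, peak_rpow hq hqm]
      have h2 : u r ^ (m - q) ≤ 1 := Real.rpow_le_one hu.le (h.le_one hp hqp hm hr) (by linarith)
      rw [div_le_iff₀ (div_pos (by linarith) hq), ← mul_div_assoc, le_div_iff₀ hq]
      nlinarith
    linarith
  rw [h.deriv_eq_speed hp hq hqm hr0, neg_le_neg_iff, mul_right_comm]
  gcongr

/-- For q = p-1 the exponent (q+1)/p is 1, so log u has slope at most -c beyond `unitRadius`, where
it starts at most at 0. For r ≥ 2 `unitRadius` the elapsed length is at least r/2, whence the factor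
1/2 in the rate. -/
lemma exp_decay (h : IsPositiveSolution p q m u) (hp : 1 < p) (hqp : q = p - 1)
    (hm : 2 * q + 1 < m) {r : ℝ} (hr : 2 * unitRadius p q ≤ r) :
    u r ≤ Real.exp (-(kappa p q * (1 / 2) ^ (1 / p) / 2 * r)) := by
  have hq : 0 < q + 1 := by linarith
  have hR := unitRadius_pos hp hq
  have hpos : ∀ s ∈ Ici (unitRadius p q), 0 < u s := fun s hs => h.pos s (hR.le.trans hs)
  set c := kappa p q * (1 / 2) ^ (1 / p) with hc
  have hd : ∀ s ∈ Ici (unitRadius p q),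
      HasDerivAt (fun s => Real.log (u s)) (deriv u s / u s) s := fun s hs =>
    (h.differentiableAt s (hR.trans_le hs)).hasDerivAt.log (hpos s hs).ne'
  have hmv := (convex_Ici (unitRadius p q)).image_sub_le_mul_sub_of_deriv_le (C := -c)
    (fun s hs => (hd s hs).continuousAt.continuousWithinAt)
    (fun s hs => (hd s (interior_subset hs)).differentiableAt.differentiableWithinAt)
    (fun s hs => by
      have hs' := interior_subset hs
      rw [(hd s hs').deriv, div_le_iff₀ (hpos s hs')]
      have := h.deriv_le hp hqp.ge hm hs'
      rw [show (q + 1) / p = 1 by rw [hqp]; field_simp; ring, Real.rpow_one] at this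
      linarith) (unitRadius p q) (by simp) r (mem_Ici.2 (by linarith)) (by linarith)
  have h1 : Real.log (u (unitRadius p q)) ≤ 0 :=
    Real.log_nonpos (hpos _ (by simp)).le (h.le_one hp hqp.ge hm le_rfl)
  have hc0 : 0 < c := by
    have := kappa_pos hp hq
    positivity
  rw [← Real.log_le_iff_le_exp (h.pos r (by linarith))]
  nlinarith

/-- The prefactor of the algebraic decay. -/
noncomputable def _root_.GNOneDim.decayConst (p q : ℝ) : ℝ :=
  (1 + kappa p q * ((q + 1 - p) / p * (kappa p q * (1 / 2) ^ (1 / p)) / 2)⁻¹) *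
    ((q + 1 - p) / p * (kappa p q * (1 / 2) ^ (1 / p)) / 2) ^ (-(p / (q + 1 - p)))

/-- With δ = (q+1)/p - 1 > 0, the differential inequality says that u^(-δ) has slope at least δc, so
u^(-δ) ≥ δcr/2 once r ≥ 2 `unitRadius`. The bound on r|u'| follows from |u'| ≤ κ u^δ u, since u^δ
absorbs the factor r. -/
lemma algebraic_decay (h : IsPositiveSolution p q m u) (hp : 1 < p) (hqp : p - 1 < q)
    (hm : 2 * q + 1 < m) {r : ℝ} (hr : 2 * unitRadius p q ≤ r) :
    u r + r * |deriv u r| ≤ decayConst p q * r ^ (-(p / (q + 1 - p))) := by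
  have hq : 0 < q + 1 := by linarith
  have hqm : q < m := by linarith
  have hR := unitRadius_pos hp hq
  have hr0 : 0 < r := by linarith
  have hk := kappa_pos hp hq
  have hpos : ∀ s ∈ Ici (unitRadius p q), 0 < u s := fun s hs => h.pos s (hR.le.trans hs)
  set c := kappa p q * (1 / 2) ^ (1 / p) with hc
  have hc0 : 0 < c := by positivity
  set δ := (q + 1 - p) / p with hδ
  have hδ0 : 0 < δ := div_pos (by linarith) (by linarith)
  have hδ1 : (q + 1) / p = δ + 1 := by rw [hδ]; field_simp; ring
  have hδ2 : -(p / (q + 1 - p)) = -δ⁻¹ := by rw [hδ, inv_div]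
  have hd : ∀ s ∈ Ici (unitRadius p q),
      HasDerivAt (fun s => u s ^ (-δ)) (deriv u s * (-δ) * u s ^ (-δ - 1)) s := fun s hs =>
    (h.differentiableAt s (hR.trans_le hs)).hasDerivAt.rpow_const (Or.inl (hpos s hs).ne')
  have hmv := (convex_Ici (unitRadius p q)).mul_sub_le_image_sub_of_le_deriv (C := δ * c)
    (fun s hs => (hd s hs).continuousAt.continuousWithinAt)
    (fun s hs => (hd s (interior_subset hs)).differentiableAt.differentiableWithinAt)
    (fun s hs => by
      have hs' := interior_subset hs
      rw [(hd s hs').deriv]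
      have h1 := h.deriv_le hp hqp.le hm hs'
      rw [hδ1] at h1
      have h2 := Real.rpow_pos_of_pos (hpos s hs') (-δ - 1)
      have h3 : u s ^ (δ + 1) * u s ^ (-δ - 1) = 1 := by
        rw [← Real.rpow_add (hpos s hs')]; ring_nf; exact Real.rpow_zero _
      calc δ * c = δ * (c * u s ^ (δ + 1)) * u s ^ (-δ - 1) := by
            rw [mul_assoc, mul_assoc, h3, mul_one]
        _ ≤ δ * (-deriv u s) * u s ^ (-δ - 1) := by
            gcongr
            linarith
        _ = _ := by ring) (unitRadius p q) (by simp) r (mem_Ici.2 (by linarith)) (by linarith)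
  have hV0 := Real.rpow_pos_of_pos (hpos (unitRadius p q) (by simp)) (-δ)
  have hδc : 0 < δ * c := by positivity
  have hV : δ * c / 2 * r ≤ u r ^ (-δ) := by nlinarith
  have hur := h.pos r hr0.le
  have hD : 0 < δ * c / 2 := by positivity
  have hu1 : u r ≤ (δ * c / 2) ^ (-δ⁻¹) * r ^ (-δ⁻¹) := by
    rw [← Real.mul_rpow hD.le hr0.le]
    calc u r = (u r ^ (-δ)) ^ (-δ⁻¹) := by
          rw [← Real.rpow_mul hur.le, neg_mul_neg, mul_inv_cancel₀ hδ0.ne', Real.rpow_one]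
      _ ≤ _ := Real.rpow_le_rpow_of_nonpos (by positivity) hV (by simp [hδ0.le])
  have hud : u r ^ δ ≤ (δ * c / 2 * r)⁻¹ := by
    rw [le_inv_comm₀ (Real.rpow_pos_of_pos hur _) (by positivity), ← Real.rpow_neg hur.le]
    exact hV
  have hdu : r * |deriv u r| ≤ kappa p q * (δ * c / 2)⁻¹ * u r := by
    rw [abs_of_neg (h.deriv_neg hp hq hqm r hr0), h.deriv_eq_speed hp hq hqm hr0, neg_neg, hδ1,
      Real.rpow_add_one hur.ne']
    have hX := h.one_sub_pos hp hq hqm hr0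
    have hX1 : (1 - (u r / peak q m) ^ (m - q)) ^ (1 / p) ≤ 1 := by
      refine Real.rpow_le_one hX.le ?_ (by positivity)
      have := Real.rpow_pos_of_pos (div_pos hur (peak_pos hq hqm)) (m - q)
      linarith
    calc r * (kappa p q * (u r ^ δ * u r) * (1 - (u r / peak q m) ^ (m - q)) ^ (1 / p))
        ≤ r * (kappa p q * ((δ * c / 2 * r)⁻¹ * u r) * 1) := by gcongr
      _ = _ := by field_simp
  rw [decayConst, ← hδ, ← hc, hδ2]
  have h1 : 0 < 1 + kappa p q * (δ * c / 2)⁻¹ := by positivity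
  calc u r + r * |deriv u r| ≤ (1 + kappa p q * (δ * c / 2)⁻¹) * u r := by linarith
    _ ≤ (1 + kappa p q * (δ * c / 2)⁻¹) * ((δ * c / 2) ^ (-δ⁻¹) * r ^ (-δ⁻¹)) := by gcongr
    _ = _ := by ring

lemma _root_.GNOneDim.decayConst_pos (hp : 1 < p) (hqp : p - 1 < q) : 0 < decayConst p q := by
  have hk := kappa_pos hp (show 0 < q + 1 by linarith)
  have : 0 < (q + 1 - p) / p := div_pos (by linarith) (by linarith)
  unfold decayConst
  positivity

end IsPositiveSolution

end GNOneDim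

/-! ### Integral identities for the ground state and its even extension -/

namespace GNOneDim

namespace IsPositiveSolution

variable {p q m : ℝ} {u : ℝ → ℝ}

lemma continuousWithinAt_comp (h : IsPositiveSolution p q m u) {f : ℝ → ℝ} (hf : Continuous f) :
    ContinuousWithinAt (fun r => f (u r)) (Ici 0) 0 :=
  hf.continuousAt.comp_continuousWithinAt h.deriv_zero.continuousWithinAt

/-- Beyond r = 1 the equation gives -u' ≥ const · u^((q+1)/p), so u^(q+1) is dominated by a multiple
of -(u^e)', which is integrable because u^e is monotone with a limit. This treats the exponential
and the algebraic regime at once. -/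
lemma integrableOn_rpow (h : IsPositiveSolution p q m u) (hp : 1 < p) (hq : 0 < q + 1)
    (hm : q < m) : IntegrableOn (fun r => u r ^ (q + 1)) (Ioi 0) := by
  have ha : 0 < 1 - 1 / p := by rw [sub_pos, div_lt_one (by linarith)]; exact hp
  -- Chosen so that u^(q+1) = u^((q+1)/p) · u^(e-1).
  set e := (q + 1) * (1 - 1 / p) + 1 with he
  have he0 : 0 < e := by positivity
  have hint : IntegrableOn (fun r => -(deriv u r * e * u r ^ (e - 1))) (Ioi 0) := by
    refine integrableOn_Ioi_deriv_of_nonneg (g := fun r => -(u r ^ e)) (l := -0)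
      ?_ (fun r hr => ?_) (fun r hr => ?_) ?_
    · exact (h.continuousWithinAt_comp (Real.continuous_rpow_const he0.le)).neg
    · exact ((h.differentiableAt r hr).hasDerivAt.rpow_const (Or.inl (h.pos r (le_of_lt hr)).ne')).neg
    · have h1 := h.deriv_neg hp hq hm r hr
      have h2 := Real.rpow_pos_of_pos (h.pos r (le_of_lt hr)) (e - 1)
      have := mul_pos (mul_pos (neg_pos.2 h1) he0) h2
      linarith
    · have := (h.tendsto_zero.rpow_const (p := e) (Or.inr he0.le)).neg
      rwa [Real.zero_rpow he0.ne'] at this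
  have hX1 := h.one_sub_pos hp hq hm one_pos
  set c := e * (kappa p q * (1 - (u 1 / peak q m) ^ (m - q)) ^ (1 / p)) with hc
  have hk := kappa_pos hp hq
  have hc0 : 0 < c := mul_pos he0 (mul_pos hk (Real.rpow_pos_of_pos hX1 _))
  have hpk := peak_pos hq hm
  have hcont : ContinuousOn (fun r => u r ^ (q + 1)) (Ici 0) :=
    h.continuousOn.rpow_const fun r _ => Or.inr hq.le
  have hIoi : IntegrableOn (fun r => u r ^ (q + 1)) (Ioi 1) := by
    refine Integrable.mono' ((hint.mono_set (Ioi_subset_Ioi zero_le_one)).const_mul c⁻¹) ?_ ?_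
    · exact (hcont.mono fun x (hx : (1 : ℝ) < x) => mem_Ici.2 (by linarith)).aestronglyMeasurable
        measurableSet_Ioi
    · refine (ae_restrict_iff' measurableSet_Ioi).2 (Eventually.of_forall fun r hr => ?_)
      have hr1 : (1 : ℝ) < r := hr
      have hr0 : 0 < r := by linarith
      have hu := h.pos r hr0.le
      rw [Real.norm_of_nonneg (Real.rpow_nonneg hu.le _), inv_mul_eq_div, le_div_iff₀ hc0,
        h.deriv_eq_speed hp hq hm hr0]
      have hXle : 1 - (u 1 / peak q m) ^ (m - q) ≤ 1 - (u r / peak q m) ^ (m - q) := by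
        have := h.strictAntiOn hp hq hm (mem_Ici.2 zero_le_one) (mem_Ici.2 hr0.le) hr1
        gcongr
      have hsplit : u r ^ (q + 1) = u r ^ ((q + 1) / p) * u r ^ (e - 1) := by
        rw [← Real.rpow_add hu]; congr 1; rw [he]; ring
      rw [hsplit, hc]
      have hX := h.one_sub_pos hp hq hm hr0
      calc u r ^ ((q + 1) / p) * u r ^ (e - 1) *
            (e * (kappa p q * (1 - (u 1 / peak q m) ^ (m - q)) ^ (1 / p)))
          ≤ u r ^ ((q + 1) / p) * u r ^ (e - 1) *
            (e * (kappa p q * (1 - (u r / peak q m) ^ (m - q)) ^ (1 / p))) := by gcongr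
        _ = _ := by ring
  rw [← Ioc_union_Ioi_eq_Ioi zero_le_one]
  refine IntegrableOn.union ?_ hIoi
  exact ((hcont.mono (fun x hx => hx.1)).integrableOn_Icc (a := 0) (b := 1)).mono_set
    Ioc_subset_Icc_self

lemma integrableOn_rpow' (h : IsPositiveSolution p q m u) (hp : 1 < p) (hq : 0 < q + 1)
    (hm : q < m) : IntegrableOn (fun r => u r ^ (m + 1)) (Ioi 0) := by
  refine Integrable.mono' ((h.integrableOn_rpow hp hq hm).const_mul (peak q m ^ (m - q))) ?_ ?_
  · refine ContinuousOn.aestronglyMeasurable ?_ measurableSet_Ioi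
    exact (h.continuousOn.mono Ioi_subset_Ici_self).rpow_const fun r _ => Or.inr (by linarith)
  · refine (ae_restrict_iff' measurableSet_Ioi).2 (Eventually.of_forall fun r hr => ?_)
    have hu := h.pos r (le_of_lt hr)
    rw [Real.norm_of_nonneg (Real.rpow_nonneg hu.le _),
      show m + 1 = (m - q) + (q + 1) by ring, Real.rpow_add hu]
    have := h.le_peak hp hq hm hr
    gcongr

/-- Integrated energy identity. -/
lemma integral_energy (h : IsPositiveSolution p q m u) (hp : 1 < p) (hq : 0 < q + 1)
    (hm : q < m) : IntegrableOn (fun r => |deriv u r| ^ p) (Ioi 0) ∧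
      ∫ r in Ioi 0, |deriv u r| ^ p = p / (p - 1) *
        ((∫ r in Ioi 0, u r ^ (q + 1)) / (q + 1) - (∫ r in Ioi 0, u r ^ (m + 1)) / (m + 1)) := by
  have hB := h.integrableOn_rpow hp hq hm
  have hA := h.integrableOn_rpow' hp hq hm
  have heq : EqOn (fun r => |deriv u r| ^ p)
      (fun r => p / (p - 1) * (u r ^ (q + 1) / (q + 1) - u r ^ (m + 1) / (m + 1))) (Ioi 0) :=
    fun r hr => h.energy hp hq (by linarith) r hr
  constructor
  · exact IntegrableOn.congr_fun
      (((hB.div_const (q + 1)).sub (hA.div_const (m + 1))).const_mul (p / (p - 1))) heq.symm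
      measurableSet_Ioi
  · rw [setIntegral_congr_fun measurableSet_Ioi heq, integral_const_mul,
      integral_sub (hB.div_const _) (hA.div_const _), integral_div, integral_div]

/-- Writes the flux as a continuous function of u alone, so that boundary terms at 0 and at infinity
follow from the behaviour of u. -/
lemma flux_eq (h : IsPositiveSolution p q m u) (hp : 1 < p) (hq : 0 < q + 1) (hm : q < m)
    {r : ℝ} (hr : 0 < r) : |deriv u r| ^ (p - 2) * deriv u r =
      -(p / (p - 1) * potential q m (u r)) ^ ((p - 1) / p) := by
  have h1 := h.deriv_neg hp hq hm r hr
  rw [← h.energy hp hq (by linarith) r hr, ← Real.rpow_mul (abs_nonneg _),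
    mul_div_cancel₀ _ (by linarith)]
  have h2 : 0 < |deriv u r| := abs_pos.2 h1.ne
  nth_rewrite 2 [← neg_neg (deriv u r)]
  rw [← abs_of_neg h1, mul_neg, ← Real.rpow_add_one h2.ne']
  congr 2; ring

/-- Testing the equation with the solution itself. -/
lemma integral_nehari (h : IsPositiveSolution p q m u) (hp : 1 < p) (hq : 0 < q + 1)
    (hm : q < m) : ∫ r in Ioi 0, |deriv u r| ^ p =
      (∫ r in Ioi 0, u r ^ (m + 1)) - ∫ r in Ioi 0, u r ^ (q + 1) := by
  have hm1 : 0 < m + 1 := by linarith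
  have ha : 0 < (p - 1) / p := div_pos (by linarith) (by linarith)
  have hB := h.integrableOn_rpow hp hq hm
  have hA := h.integrableOn_rpow' hp hq hm
  have hP := (h.integral_energy hp hq hm).1
  have hcont : Continuous fun s => -(p / (p - 1) * potential q m s) ^ ((p - 1) / p) * s :=
    (((Real.continuous_rpow_const ha.le).comp
      ((continuous_potential hq hm1).const_mul _)).neg).mul continuous_id
  -- The differentiated function is flux times u. It vanishes at 0, where the potential does, and at
  -- infinity, where u does.
  have hval := integral_Ioi_of_hasDerivAt_of_tendsto
    (f := fun r => -(p / (p - 1) * potential q m (u r)) ^ ((p - 1) / p) * u r)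
    (f' := fun r => u r ^ (q + 1) - u r ^ (m + 1) + |deriv u r| ^ p)
    (h.continuousWithinAt_comp hcont) (fun r hr => ?_) ((hB.sub hA).add hP)
    (hcont.continuousAt.tendsto.comp h.tendsto_zero)
  · have hsum : ∫ r in Ioi 0, (u r ^ (q + 1) - u r ^ (m + 1) + |deriv u r| ^ p) =
        (∫ r in Ioi 0, u r ^ (q + 1)) - (∫ r in Ioi 0, u r ^ (m + 1)) +
          ∫ r in Ioi 0, |deriv u r| ^ p := by
      rw [← integral_sub hB hA]
      exact integral_add (hB.sub hA) hP
    rw [hsum, h.apply_zero hp hq hm,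
      potential_peak hq hm] at hval
    simp only [mul_zero, Real.zero_rpow ha.ne', neg_zero, zero_mul, sub_zero] at hval
    linarith
  · have hr0 : 0 < r := hr
    have hu := h.pos r hr0.le
    have h1 := (h.differentiableAt_flux r hr).hasDerivAt.mul (h.differentiableAt r hr).hasDerivAt
    refine (h1.congr_of_eventuallyEq ?_).congr_deriv ?_
    · filter_upwards [Ioi_mem_nhds hr0] with s hs
      rw [Pi.mul_apply, h.flux_eq hp hq hm hs]
    · have h2 : deriv (fun s => |deriv u s| ^ (p - 2) * deriv u s) r = u r ^ q - u r ^ m := by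
        linarith [h.equation r hr]
      have h3 : 0 < |deriv u r| := abs_pos.2 (h.deriv_neg hp hq hm r hr).ne
      rw [h2, sub_mul, ← Real.rpow_add_one hu.ne', ← Real.rpow_add_one hu.ne', mul_assoc,
        ← abs_mul_abs_self, ← mul_assoc, ← Real.rpow_add_one h3.ne', ← Real.rpow_add_one h3.ne']
      congr 2; ring

/-- The energy of the profile as an integral over its range. -/
lemma integral_deriv_rpow (h : IsPositiveSolution p q m u) (hp : 1 < p) (hq : 0 < q + 1)
    (hm : q < m) : ∫ r in Ioi 0, |deriv u r| ^ p =
      ∫ s in (0 : ℝ)..peak q m, (p / (p - 1) * potential q m s) ^ ((p - 1) / p) := by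
  have hm1 : 0 < m + 1 := by linarith
  have ha : 0 < (p - 1) / p := div_pos (by linarith) (by linarith)
  have hcont : Continuous fun s => (p / (p - 1) * potential q m s) ^ ((p - 1) / p) :=
    (Real.continuous_rpow_const ha.le).comp ((continuous_potential hq hm1).const_mul _)
  set G : ℝ → ℝ := fun x => ∫ s in (0 : ℝ)..x, (p / (p - 1) * potential q m s) ^ ((p - 1) / p)
  have hG : ∀ x, HasDerivAt G ((p / (p - 1) * potential q m x) ^ ((p - 1) / p)) x := fun x =>
    intervalIntegral.integral_hasDerivAt_right (hcont.intervalIntegrable _ _)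
      (hcont.stronglyMeasurableAtFilter _ _) hcont.continuousAt
  have hGc : Continuous G := continuous_iff_continuousAt.2 fun x => (hG x).continuousAt
  -- Substitution s = u(r): by `flux_eq`, -G(u) has derivative |u'|^(p-1) |u'|.
  have hval := integral_Ioi_of_hasDerivAt_of_tendsto
    (f := fun r => -G (u r)) (f' := fun r => |deriv u r| ^ p)
    (h.continuousWithinAt_comp hGc).neg (fun r hr => ?_) (h.integral_energy hp hq hm).1
    (hGc.continuousAt.tendsto.comp h.tendsto_zero).neg
  · rw [hval, h.apply_zero hp hq hm]
    simp [G]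
  · have h1 := ((hG (u r)).comp r (h.differentiableAt r hr).hasDerivAt).neg
    refine h1.congr_deriv ?_
    rw [← neg_mul, ← h.flux_eq hp hq hm hr, mul_assoc]
    have h3 : 0 < |deriv u r| := abs_pos.2 (h.deriv_neg hp hq hm r hr).ne
    rw [← abs_mul_abs_self, ← mul_assoc, ← Real.rpow_add_one h3.ne', ← Real.rpow_add_one h3.ne']
    congr 1; ring

end IsPositiveSolution

lemma integrable_comp_abs {f : ℝ → ℝ} (hf : IntegrableOn f (Ioi 0)) :
    Integrable fun x => f |x| := by
  have hpos : IntegrableOn (fun x => f |x|) (Ioi 0) :=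
    hf.congr_fun (fun x hx => by rw [abs_of_pos hx]) measurableSet_Ioi
  have hneg : IntegrableOn (fun x => f |x|) (Iic 0) := by
    rw [← Measure.map_neg_eq_self (volume : Measure ℝ)]
    let e : MeasurableEmbedding fun x : ℝ => -x := (Homeomorph.neg ℝ).measurableEmbedding
    rw [e.integrableOn_map_iff]
    simp_rw [Function.comp_def, abs_neg, neg_preimage, neg_Iic, neg_zero]
    exact (integrableOn_Ici_iff_integrableOn_Ioi (by simp)).2 hpos
  rw [← integrableOn_univ, ← Iic_union_Ioi (a := (0 : ℝ))]
  exact hneg.union hpos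

namespace IsPositiveSolution

variable {p q m : ℝ} {u : ℝ → ℝ}

/-- The condition u'(0) = 0 prevents a corner at the origin, so the even extension is differentiable
everywhere and integration by parts needs no exceptional point. -/
lemma hasDerivAt_comp_abs_zero (h : IsPositiveSolution p q m u) :
    HasDerivAt (fun x => u |x|) 0 0 := by
  have h1 : HasDerivWithinAt (fun x => u |x|) 0 (Ici 0) 0 :=
    h.deriv_zero.congr (fun x hx => by rw [abs_of_nonneg hx]) (by simp)
  have h2 : HasDerivWithinAt (fun x => u |x|) 0 (Iic 0) 0 := by
    have h3 : HasDerivWithinAt (fun x : ℝ => -x) (-1) (Iic 0) 0 := hasDerivWithinAt_neg _ _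
    have h4 : HasDerivWithinAt (fun x => u |x|) 0 (Ici 0) (-0) := by rwa [neg_zero]
    have := h4.comp (0 : ℝ) h3 (fun x hx => by simpa using hx)
    simpa [Function.comp_def] using this
  have := h1.union h2
  rwa [Ici_union_Iic, hasDerivWithinAt_univ] at this

lemma hasDerivAt_comp_abs (h : IsPositiveSolution p q m u) {x : ℝ} (hx : x ≠ 0) :
    HasDerivAt (fun x => u |x|) (deriv u |x| * SignType.sign x) x :=
  (h.differentiableAt |x| (abs_pos.2 hx)).hasDerivAt.comp x (hasDerivAt_abs hx)

lemma differentiable_comp_abs (h : IsPositiveSolution p q m u) :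
    Differentiable ℝ fun x => u |x| := fun x => by
  rcases eq_or_ne x 0 with rfl | hx
  · exact h.hasDerivAt_comp_abs_zero.differentiableAt
  · exact (h.hasDerivAt_comp_abs hx).differentiableAt

lemma abs_deriv_comp_abs (h : IsPositiveSolution p q m u) {x : ℝ} (hx : x ≠ 0) :
    |deriv (fun x => u |x|) x| = |deriv u (|x|)| := by
  rw [(h.hasDerivAt_comp_abs hx).deriv, abs_mul]
  rcases hx.lt_or_gt with h0 | h0
  · simp [sign_neg h0]
  · simp [sign_pos h0]

lemma memLp_comp_abs (h : IsPositiveSolution p q m u) {s : ℝ} (hs : 0 < s)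
    (hi : IntegrableOn (fun r => u r ^ s) (Ioi 0)) :
    MemLp (fun x => u |x|) (ENNReal.ofReal s) := by
  rw [← integrable_norm_rpow_iff h.differentiable_comp_abs.continuous.aestronglyMeasurable
    (by simpa using hs) ENNReal.ofReal_ne_top, ENNReal.toReal_ofReal hs.le]
  refine (integrable_comp_abs hi).congr (Eventually.of_forall fun x => ?_)
  simp only
  rw [Real.norm_of_nonneg (h.pos _ (abs_nonneg x)).le]

lemma ae_abs_deriv_comp_abs (h : IsPositiveSolution p q m u) :
    (fun x => |deriv u (|x|)| ^ p) =ᵐ[volume] fun x => ‖deriv (fun x => u |x|) x‖ ^ p := by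
  filter_upwards [compl_mem_ae_iff.2 (measure_singleton (0 : ℝ))] with x hx
  rw [Real.norm_eq_abs, h.abs_deriv_comp_abs hx]

/-- The even extension of a ground state is admissible. -/
lemma memX (h : IsPositiveSolution p q m u) (hp : 1 < p) (hq : 0 < q + 1) (hm : q < m) :
    MemX p q (fun x => u |x|) (deriv fun x => u |x|) := by
  have hp0 : 0 < p := by linarith
  have hcont := h.differentiable_comp_abs.continuous
  have hg : MemLp (deriv fun x => u |x|) (ENNReal.ofReal p) := by
    rw [← integrable_norm_rpow_iff (measurable_deriv _).aestronglyMeasurable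
      (by simpa using hp0) ENNReal.ofReal_ne_top, ENNReal.toReal_ofReal hp0.le]
    exact (integrable_comp_abs (f := fun r => |deriv u r| ^ p)
      (h.integral_energy hp hq hm).1).congr h.ae_abs_deriv_comp_abs
  have hgl : LocallyIntegrable (deriv fun x => u |x|) volume :=
    hg.locallyIntegrable (by simpa using hp.le)
  refine ⟨h.memLp_comp_abs hq (h.integrableOn_rpow hp hq hm), hg, hcont.locallyIntegrable, hgl,
    fun φ hφ hφc => ?_⟩
  have hφ' : Continuous (deriv φ) := hφ.continuous_deriv (by simp)
  exact integral_mul_deriv_eq_deriv_mul_of_integrable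
    (fun x _ => (h.differentiable_comp_abs x).hasDerivAt)
    (fun x _ => (hφ.differentiable (by simp) x).hasDerivAt)
    ((hcont.mul hφ').integrable_of_hasCompactSupport (hφc.deriv.mul_left))
    (hgl.integrable_smul_right_of_hasCompactSupport hφ.continuous hφc)
    ((hcont.mul hφ.continuous).integrable_of_hasCompactSupport (hφc.mul_left))

end IsPositiveSolution

end GNOneDim

/-! ### Weak derivatives and absolutely continuous representatives -/

section AbsolutelyContinuous

lemma LipschitzOnWith.comp_absolutelyContinuousOnInterval {f G : ℝ → ℝ} {a b : ℝ} {K : NNReal}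
    {s : Set ℝ} (hG : LipschitzOnWith K G s) (hf : AbsolutelyContinuousOnInterval f a b)
    (hs : MapsTo f (uIcc a b) s) : AbsolutelyContinuousOnInterval (fun x => G (f x)) a b := by
  rw [absolutelyContinuousOnInterval_iff] at hf ⊢
  intro ε hε
  -- Dividing by K + 1 instead of K covers K = 0 and makes the final inequality strict.
  obtain ⟨δ, hδ, h⟩ := hf (ε / (K + 1)) (by positivity)
  refine ⟨δ, hδ, fun E hE hE' => ?_⟩
  have h1 := h E hE hE'
  calc ∑ i ∈ Finset.range E.1, dist (G (f (E.2 i).1)) (G (f (E.2 i).2))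
      ≤ ∑ i ∈ Finset.range E.1, K * dist (f (E.2 i).1) (f (E.2 i).2) :=
        Finset.sum_le_sum fun i hi => hG.dist_le_mul _ (hs (hE.1 i hi).1) _ (hs (hE.1 i hi).2)
    _ = K * ∑ i ∈ Finset.range E.1, dist (f (E.2 i).1) (f (E.2 i).2) := by rw [Finset.mul_sum]
    _ ≤ K * (ε / (K + 1)) := by gcongr
    _ < (K + 1) * (ε / (K + 1)) := by gcongr; linarith
    _ = ε := by field_simp

/-- `w` is a primitive of the locally integrable function `g`. -/
def IsLebesguePrimitive (w g : ℝ → ℝ) : Prop :=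
  LocallyIntegrable g volume ∧ ∀ x y, w y - w x = ∫ t in x..y, g t

variable {w g : ℝ → ℝ}

lemma MeasureTheory.LocallyIntegrable.isLebesguePrimitive (hg : LocallyIntegrable g volume) (c : ℝ) :
    IsLebesguePrimitive (fun x => c + ∫ t in (0 : ℝ)..x, g t) g := by
  have hi : ∀ a b, IntervalIntegrable g volume a b := fun a b =>
    (hg.integrableOn_isCompact isCompact_uIcc).intervalIntegrable
  refine ⟨hg, fun x y => ?_⟩
  rw [add_sub_add_left_eq_sub, intervalIntegral.integral_interval_sub_left (hi _ _) (hi _ _)]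

namespace IsLebesguePrimitive

lemma intervalIntegrable (h : IsLebesguePrimitive w g) (a b : ℝ) : IntervalIntegrable g volume a b :=
  (h.1.integrableOn_isCompact isCompact_uIcc).intervalIntegrable

lemma eq_add (h : IsLebesguePrimitive w g) (a : ℝ) : w = fun x => w a + ∫ t in a..x, g t := by
  ext x; rw [← h.2 a x]; ring

lemma continuous (h : IsLebesguePrimitive w g) : Continuous w := by
  rw [h.eq_add 0]
  exact continuous_const.add (intervalIntegral.continuous_primitive h.intervalIntegrable 0)

lemma absolutelyContinuousOnInterval (h : IsLebesguePrimitive w g) (a b : ℝ) :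
    AbsolutelyContinuousOnInterval w a b := by
  have h1 := (h.intervalIntegrable a b).absolutelyContinuousOnInterval_intervalIntegral
    (c := a) left_mem_uIcc
  have h2 : AbsolutelyContinuousOnInterval (fun _ : ℝ => w a) a b :=
    (LipschitzWith.const (w a)).lipschitzOnWith.absolutelyContinuousOnInterval
  have h3 := h2.add h1
  rw [h.eq_add a]
  exact h3

lemma ae_hasDerivAt (h : IsLebesguePrimitive w g) : ∀ᵐ x, HasDerivAt w (g x) x := by
  filter_upwards [LocallyIntegrable.ae_hasDerivAt_integral h.1] with x hx
  rw [h.eq_add 0]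
  exact (hx 0).const_add _

/-- Chain rule for a `C¹` function of a primitive. -/
lemma sub_eq_integral_comp (h : IsLebesguePrimitive w g) {G H : ℝ → ℝ} (hG : ∀ s, HasDerivAt G (H s) s)
    (hH : Continuous H) (a b : ℝ) : G (w b) - G (w a) = ∫ t in a..b, H (w t) * g t := by
  obtain ⟨C, hC⟩ := (h.absolutelyContinuousOnInterval a b).exists_bound
  have hcd : ContDiff ℝ 1 G := contDiff_one_iff_deriv.2
    ⟨fun s => (hG s).differentiableAt, by rwa [show deriv G = H from funext fun s => (hG s).deriv]⟩
  -- On [a, b] the function w stays in a compact interval, where the C¹ function G is Lipschitz;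
  -- hence G ∘ w is absolutely continuous and is recovered from its a.e. derivative.
  obtain ⟨K, hK⟩ := (hcd.contDiffOn (s := Icc (-C) C)).exists_lipschitzOnWith (by decide)
    (convex_Icc _ _) isCompact_Icc
  have hac := hK.comp_absolutelyContinuousOnInterval (h.absolutelyContinuousOnInterval a b)
    (fun x hx => abs_le.1 (hC x hx))
  rw [← hac.integral_deriv_eq_sub]
  refine intervalIntegral.integral_congr_ae ?_
  filter_upwards [h.ae_hasDerivAt] with x hx _
  exact ((hG (w x)).comp x hx).deriv

lemma integral_mul_deriv (h : IsLebesguePrimitive w g) {φ : ℝ → ℝ} (hφ : ContDiff ℝ 1 φ)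
    (hc : HasCompactSupport φ) : ∫ x, w x * deriv φ x = -∫ x, g x * φ x := by
  obtain ⟨R, hR⟩ := hc.isCompact.isBounded.subset_ball (0 : ℝ)
  have hsub : tsupport φ ⊆ Ioo (-R) R := by
    simpa [Real.ball_eq_Ioo] using hR
  rcases le_or_gt R 0 with hR0 | hR0
  · have : tsupport φ = ∅ := by
      rw [← subset_empty_iff]; exact hsub.trans (by rw [Ioo_eq_empty]; linarith)
    have hφ0 : φ = 0 := tsupport_eq_empty_iff.1 this
    simp [hφ0]
  have hz : ∀ x, x ∉ Ioo (-R) R → φ x = 0 := fun x hx =>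
    image_eq_zero_of_notMem_tsupport fun h' => hx (hsub h')
  have hz' : ∀ x, x ∉ Ioo (-R) R → deriv φ x = 0 := fun x hx =>
    image_eq_zero_of_notMem_tsupport fun h' => hx (hsub (tsupport_deriv_subset h'))
  have e1 : ∫ x, w x * deriv φ x = ∫ x in (-R)..R, w x * deriv φ x := by
    rw [intervalIntegral.integral_of_le (by linarith), ← integral_Icc_eq_integral_Ioc]
    refine (setIntegral_eq_integral_of_forall_compl_eq_zero fun x hx => ?_).symm
    rw [hz' x fun h' => hx (Ioo_subset_Icc_self h'), mul_zero]
  have e2 : ∫ x, g x * φ x = ∫ x in (-R)..R, g x * φ x := by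
    rw [intervalIntegral.integral_of_le (by linarith), ← integral_Icc_eq_integral_Ioc]
    refine (setIntegral_eq_integral_of_forall_compl_eq_zero fun x hx => ?_).symm
    rw [hz x fun h' => hx (Ioo_subset_Icc_self h'), mul_zero]
  rw [e1, e2, (h.absolutelyContinuousOnInterval (-R) R).integral_mul_deriv_eq_deriv_mul
    (hφ.contDiffOn.absolutelyContinuousOnInterval), hz R (by simp), hz (-R) (by simp), mul_zero,
    mul_zero, sub_zero, zero_sub]
  congr 1
  refine intervalIntegral.integral_congr_ae ?_
  filter_upwards [h.ae_hasDerivAt] with x hx _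
  rw [hx.deriv]

end IsLebesguePrimitive

/-- The primitive from -∞ vanishes to the left of the support, and to its right because the total
integral is 0. -/
lemma ContDiff.exists_primitive_of_integral_eq_zero {ψ : ℝ → ℝ} (hψ : ContDiff ℝ (⊤ : ℕ∞) ψ)
    (hc : HasCompactSupport ψ) (h0 : ∫ x, ψ x = 0) :
    ∃ Ψ : ℝ → ℝ, ContDiff ℝ (⊤ : ℕ∞) Ψ ∧ HasCompactSupport Ψ ∧ deriv Ψ = ψ := by
  obtain ⟨R, hR⟩ := hc.isCompact.isBounded.subset_closedBall (0 : ℝ)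
  have hsub : tsupport ψ ⊆ Icc (-R) R := by
    simpa [Real.closedBall_eq_Icc] using hR
  have hz : ∀ x, x ∉ Icc (-R) R → ψ x = 0 := fun x hx =>
    image_eq_zero_of_notMem_tsupport fun h' => hx (hsub h')
  have hcont := hψ.continuous
  have hint := hcont.integrable_of_hasCompactSupport (μ := volume) hc
  have hd : ∀ x, HasDerivAt (fun x => ∫ t in Iic x, ψ t) (ψ x) x := by
    intro x
    have h1 := intervalIntegral.integral_hasDerivAt_right (hcont.intervalIntegrable 0 x)
      (hcont.stronglyMeasurableAtFilter _ _) hcont.continuousAt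
    have h2 : (fun x => ∫ t in Iic x, ψ t) =
        fun x => (∫ t in Iic 0, ψ t) + ∫ t in (0 : ℝ)..x, ψ t := by
      ext y
      rw [← intervalIntegral.integral_Iic_sub_Iic hint.integrableOn hint.integrableOn]
      ring
    rw [h2]
    exact h1.const_add _
  have hderiv : deriv (fun x => ∫ t in Iic x, ψ t) = ψ := funext fun x => (hd x).deriv
  refine ⟨fun x => ∫ t in Iic x, ψ t, ?_, ?_, hderiv⟩
  · rw [contDiff_infty_iff_deriv, hderiv]
    exact ⟨fun x => (hd x).differentiableAt, hψ⟩
  · refine HasCompactSupport.intro (isCompact_Icc (a := -R) (b := R)) fun x hx => ?_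
    rw [mem_Icc, not_and_or, not_le, not_le] at hx
    rcases hx with hx | hx
    · refine setIntegral_eq_zero_of_forall_eq_zero fun t ht => hz t fun h' => ?_
      have : t ≤ x := ht
      linarith [h'.1]
    · rw [← h0]
      refine setIntegral_eq_integral_of_forall_compl_eq_zero fun t ht => hz t fun h' => ?_
      have : x < t := not_le.1 ht
      linarith [h'.2]

/-- A locally integrable function with vanishing distributional derivative is constant. -/
lemma MeasureTheory.LocallyIntegrable.ae_eq_const_of_integral_mul_deriv_eq_zero
    (hw : LocallyIntegrable w volume) (h : ∀ φ : ℝ → ℝ, ContDiff ℝ (⊤ : ℕ∞) φ →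
      HasCompactSupport φ → ∫ x, w x * deriv φ x = 0) : ∃ c : ℝ, ∀ᵐ x, w x = c := by
  let f : ContDiffBump (0 : ℝ) := ⟨1, 2, one_pos, one_lt_two⟩
  set φ₀ : ℝ → ℝ := f.normed volume with hφ₀
  have hs₀ : ContDiff ℝ (⊤ : ℕ∞) φ₀ := f.contDiff_normed
  have hc₀ : HasCompactSupport φ₀ := f.hasCompactSupport_normed
  have hi₀ : ∫ x, φ₀ x = 1 := f.integral_normed
  refine ⟨∫ x, w x * φ₀ x, ?_⟩
  set c := ∫ x, w x * φ₀ x with hc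
  have key : ∀ᵐ x, w x - c = 0 := by
    refine ae_eq_zero_of_integral_contDiff_smul_eq_zero (f := fun x => w x - c)
      (hw.sub (continuous_const.locallyIntegrable)) fun φ hφ hφc => ?_
    have hφi := hφ.continuous.integrable_of_hasCompactSupport (μ := volume) hφc
    have hφ₀i := hs₀.continuous.integrable_of_hasCompactSupport (μ := volume) hc₀
    -- Subtracting (∫φ) φ₀ makes the mean zero, so the difference is the derivative of a test
    -- function and is annihilated by w. This leaves ∫wφ = c∫φ.
    obtain ⟨Ψ, hΨ, hΨc, hΨd⟩ := ContDiff.exists_primitive_of_integral_eq_zero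
      (ψ := fun x => φ x - (∫ y, φ y) * φ₀ x) (hφ.sub (contDiff_const.mul hs₀))
      (hφc.sub (hc₀.mul_left)) (by
        rw [integral_sub hφi (hφ₀i.const_mul _), integral_const_mul, hi₀, mul_one, sub_self])
    have h1 := h Ψ hΨ hΨc
    rw [hΨd] at h1
    have hwφ : Integrable fun x => w x * φ x :=
      hw.integrable_smul_right_of_hasCompactSupport hφ.continuous hφc
    have hwφ₀ : Integrable fun x => w x * φ₀ x :=
      hw.integrable_smul_right_of_hasCompactSupport hs₀.continuous hc₀
    have h2 : ∫ x, w x * (φ x - (∫ y, φ y) * φ₀ x) = (∫ x, w x * φ x) - (∫ y, φ y) * c := by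
      rw [hc, ← integral_const_mul, ← integral_sub hwφ (hwφ₀.const_mul _)]
      congr 1; ext x; ring
    have h3 : ∫ x, φ x • (w x - c) = (∫ x, w x * φ x) - (∫ y, φ y) * c := by
      rw [← integral_mul_const, ← integral_sub hwφ (hφi.mul_const _)]
      congr 1; ext x; rw [smul_eq_mul]; ring
    rw [h3, ← h2, h1]
  filter_upwards [key] with x hx using sub_eq_zero.1 hx

/-- A primitive V of g also has weak derivative g, so v - V has zero distributional derivative and
is a.e. constant. -/
lemma GNOneDim.HasWeakDeriv.exists_primitive {v g : ℝ → ℝ} (h : GNOneDim.HasWeakDeriv v g) :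
    ∃ w : ℝ → ℝ, IsLebesguePrimitive w g ∧ v =ᵐ[volume] w := by
  obtain ⟨hv, hg, hvg⟩ := h
  have hV := hg.isLebesguePrimitive 0
  set V : ℝ → ℝ := fun x => 0 + ∫ t in (0 : ℝ)..x, g t
  have hVc := hV.continuous
  obtain ⟨c, hc⟩ := (hv.sub hVc.locallyIntegrable).ae_eq_const_of_integral_mul_deriv_eq_zero
    fun φ hφ hφc => by
      have h1 := hvg φ hφ hφc
      have h2 := hV.integral_mul_deriv (hφ.of_le (by exact_mod_cast le_top)) hφc
      have hφ' : Continuous (deriv φ) := hφ.continuous_deriv (by simp)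
      have i1 : Integrable fun x => v x * deriv φ x :=
        hv.integrable_smul_right_of_hasCompactSupport hφ' hφc.deriv
      have i2 : Integrable fun x => V x * deriv φ x :=
        hVc.locallyIntegrable.integrable_smul_right_of_hasCompactSupport hφ' hφc.deriv
      have h3 : ∫ x, (v - V) x * deriv φ x =
          (∫ x, v x * deriv φ x) - ∫ x, V x * deriv φ x := by
        rw [← integral_sub i1 i2]
        congr 1; ext x; rw [Pi.sub_apply]; ring
      rw [h3, h1, h2, sub_self]
  refine ⟨fun x => c + ∫ t in (0 : ℝ)..x, g t, hg.isLebesguePrimitive c, ?_⟩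
  filter_upwards [hc] with x hx
  have : v x - V x = c := hx
  simp only [V] at this
  linarith

end AbsolutelyContinuous

/-! ### The bound from sweeping the range twice -/

/-- Otherwise a positive constant would be integrable over a set of infinite measure. Small values
on each side of a point are all that is needed below; no limit of w at infinity has to be
established. -/
lemma MeasureTheory.Integrable.exists_abs_lt {w : ℝ → ℝ} {s δ : ℝ} (hs : 0 < s)
    (hi : Integrable fun x => |w x| ^ s) (hδ : 0 < δ) {S : Set ℝ} (hS : MeasurableSet S)
    (hSv : volume S = ⊤) : ∃ x ∈ S, |w x| < δ := by
  by_contra! h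
  have h1 : IntegrableOn (fun _ : ℝ => δ ^ s) S := by
    refine Integrable.mono' hi.integrableOn aestronglyMeasurable_const ?_
    refine (ae_restrict_iff' hS).2 (Eventually.of_forall fun x hx => ?_)
    rw [Real.norm_of_nonneg (by positivity)]
    exact Real.rpow_le_rpow hδ.le (h x hx) hs.le
  rw [integrableOn_const_iff] at h1
  rcases h1 with h1 | h1
  · exact (Real.rpow_pos_of_pos hδ s).ne' (enorm_eq_zero.1 h1)
  · rw [hSv] at h1; exact lt_irrefl _ h1

namespace IsLebesguePrimitive

variable {w g : ℝ → ℝ}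

/-- The co-area type bound behind the one-dimensional inequality: a function vanishing at `±∞`
sweeps the range `[0, |w x₀|]` at least twice. -/
lemma two_mul_integral_le (h : IsLebesguePrimitive w g) {s : ℝ} (hs : 0 < s)
    (hi : Integrable fun x => |w x| ^ s) {H : ℝ → ℝ} (hH : Continuous H) (hH0 : ∀ t, 0 ≤ H t)
    (heven : ∀ t, H (-t) = H t) (hgH : Integrable fun x => |g x| * H (w x)) (x₀ : ℝ) :
    2 * ∫ t in (0 : ℝ)..|w x₀|, H t ≤ ∫ x, |g x| * H (w x) := by
  set G : ℝ → ℝ := fun y => ∫ t in (0 : ℝ)..y, H t with hGdef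
  have hG : ∀ y, HasDerivAt G (H y) y := fun y =>
    intervalIntegral.integral_hasDerivAt_right (hH.intervalIntegrable _ _)
      (hH.stronglyMeasurableAtFilter _ _) hH.continuousAt
  -- H is even, so its primitive G is odd, and |G(w)| = G(|w|): the sign of w plays no role.
  have hGneg : ∀ y, G (-y) = -G y := fun y => by
    have h1 := intervalIntegral.integral_comp_neg (f := H) (a := 0) (b := y)
    simp only [heven, neg_zero] at h1
    simp only [hGdef]
    rw [h1, intervalIntegral.integral_symm]
  have hGabs : ∀ y, |G y| = G |y| := fun y => by
    rcases le_total 0 y with h0 | h0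
    · rw [abs_of_nonneg h0, abs_of_nonneg (intervalIntegral.integral_nonneg h0 fun t _ => hH0 t)]
    · rw [abs_of_nonpos h0, hGneg, abs_of_nonpos]
      have : 0 ≤ G (-y) := intervalIntegral.integral_nonneg (by linarith) fun t _ => hH0 t
      rw [hGneg] at this
      linarith
  have hstep : ∀ a b, a ≤ b → |G (w b) - G (w a)| ≤ ∫ x in a..b, |g x| * H (w x) := by
    intro a b hab
    rw [h.sub_eq_integral_comp hG hH]
    refine (intervalIntegral.abs_integral_le_integral_abs hab).trans_eq ?_
    refine intervalIntegral.integral_congr fun x _ => ?_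
    simp only [abs_mul, abs_of_nonneg (hH0 _), mul_comm]
  have hG0 : Tendsto G (𝓝 0) (𝓝 0) := by
    have := (hG 0).continuousAt.tendsto
    rwa [show G 0 = 0 by simp [hGdef]] at this
  refine le_of_forall_pos_le_add fun ε hε => ?_
  obtain ⟨δ, hδ, hδ'⟩ := Metric.tendsto_nhds_nhds.1 hG0 (ε / 2) (by positivity)
  have hsmall : ∀ y, |y| < δ → |G y| < ε / 2 := fun y hy => by
    simpa using hδ' (by simpa using hy)
  -- On each side of x₀ there is a point where |G(w)| < ε/2. Each of the two disjoint intervals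
  -- contributes at least G(|w x₀|) - ε/2.
  obtain ⟨a, ha, ha'⟩ := hi.exists_abs_lt hs hδ (S := Iio x₀) measurableSet_Iio (by simp)
  obtain ⟨b, hb, hb'⟩ := hi.exists_abs_lt hs hδ (S := Ioi x₀) measurableSet_Ioi (by simp)
  have h1 := hstep a x₀ (le_of_lt ha)
  have h2 := hstep x₀ b (le_of_lt hb)
  have h3 := hsmall _ ha'
  have h4 := hsmall _ hb'
  have h5 : (∫ x in a..x₀, |g x| * H (w x)) + ∫ x in x₀..b, |g x| * H (w x) =
      ∫ x in a..b, |g x| * H (w x) :=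
    intervalIntegral.integral_add_adjacent_intervals hgH.intervalIntegrable hgH.intervalIntegrable
  have h6 : ∫ x in a..b, |g x| * H (w x) ≤ ∫ x, |g x| * H (w x) := by
    rw [intervalIntegral.integral_of_le ((le_of_lt ha).trans (le_of_lt hb))]
    exact setIntegral_le_integral hgH
      (Eventually.of_forall fun x => mul_nonneg (abs_nonneg _) (hH0 _))
  have h7 : G |w x₀| = |G (w x₀)| := (hGabs _).symm
  change 2 * G |w x₀| ≤ _
  have h8 := abs_sub_abs_le_abs_sub (G (w x₀)) (G (w a))
  have h9 := abs_sub_abs_le_abs_sub (G (w x₀)) (G (w b))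
  rw [abs_sub_comm (G (w x₀)) (G (w b))] at h9
  linarith

end IsLebesguePrimitive

/-! ### The sharp interpolation inequality -/

namespace GNOneDim

/-- `∫₀¹ (t^(q+1) - t^(m+1))^((p-1)/p) dt`. -/
noncomputable def profileIntegral (p q m : ℝ) : ℝ :=
  ∫ t in (0 : ℝ)..1, (t ^ (q + 1) - t ^ (m + 1)) ^ ((p - 1) / p)

lemma integral_scaled_profile {p q m M : ℝ} (hp : 1 < p) (hq : 0 < q + 1) (hm : q < m)
    (hM : 0 < M) :
    ∫ s in (0 : ℝ)..M, (M ^ (m - q) * s ^ (q + 1) - s ^ (m + 1)) ^ ((p - 1) / p) =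
      M ^ (1 + (m + 1) * ((p - 1) / p)) * profileIntegral p q m := by
  have h1 := intervalIntegral.mul_integral_comp_mul_left (a := 0) (b := 1) (c := M)
    (f := fun s => (M ^ (m - q) * s ^ (q + 1) - s ^ (m + 1)) ^ ((p - 1) / p))
  rw [mul_zero, mul_one] at h1
  rw [← h1, Real.rpow_one_add' hM.le, mul_assoc, profileIntegral]
  · congr 1
    rw [← intervalIntegral.integral_const_mul]
    refine intervalIntegral.integral_congr fun t ht => ?_
    rw [uIcc_of_le zero_le_one] at ht
    have h2 : M ^ (m - q) * (M * t) ^ (q + 1) - (M * t) ^ (m + 1) =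
        M ^ (m + 1) * (t ^ (q + 1) - t ^ (m + 1)) := by
      rw [Real.mul_rpow hM.le ht.1, Real.mul_rpow hM.le ht.1, ← mul_assoc, ← Real.rpow_add hM]
      ring_nf
    have h3 : 0 ≤ t ^ (q + 1) - t ^ (m + 1) := by
      rw [sub_nonneg]
      rcases ht.1.eq_or_lt with h0 | h0
      · rw [← h0, Real.zero_rpow hq.ne', Real.zero_rpow (by linarith)]
      · exact Real.rpow_le_rpow_of_exponent_ge h0 ht.2 (by linarith)
    rw [h2, Real.mul_rpow (by positivity) h3, ← Real.rpow_mul hM.le]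
  · have : 0 < (p - 1) / p := div_pos (by linarith) (by linarith)
    have : 0 < (m + 1) * ((p - 1) / p) := mul_pos (by linarith) this
    linarith

lemma profileIntegral_pos {p q m : ℝ} (hp : 1 < p) (hq : 0 < q + 1) (hm : q < m) :
    0 < profileIntegral p q m := by
  have ha : 0 < (p - 1) / p := div_pos (by linarith) (by linarith)
  refine intervalIntegral.intervalIntegral_pos_of_pos_on ?_ (fun t ht => ?_) zero_lt_one
  · have hc : Continuous fun t : ℝ => (t ^ (q + 1) - t ^ (m + 1)) ^ ((p - 1) / p) :=
      (Real.continuous_rpow_const ha.le).comp ((Real.continuous_rpow_const hq.le).sub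
        (Real.continuous_rpow_const (by linarith)))
    exact hc.intervalIntegrable _ _
  · exact Real.rpow_pos_of_pos (sub_pos.2
      (Real.rpow_lt_rpow_of_exponent_gt ht.1 ht.2 (by linarith))) _

/-- Maximising `α x^a - β x^c` over `x > 0`. -/
lemma rpow_sub_rpow_le {a c α β x : ℝ} (ha : 0 < a) (hac : a < c) (hα : 0 ≤ α) (hβ : 0 < β)
    (hx : 0 < x) : α * x ^ a - β * x ^ c ≤
      (c - a) / c * (a / c) ^ (a / (c - a)) * α ^ (c / (c - a)) * β ^ (-(a / (c - a))) := by
  have hc : 0 < c := ha.trans hac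
  have hca : 0 < c - a := sub_pos.2 hac
  have hconj : (c / a).HolderConjugate (c / (c - a)) := by
    rw [Real.holderConjugate_iff]
    refine ⟨(one_lt_div ha).2 hac, ?_⟩
    field_simp; ring
  -- The weight for which the first term in Young's inequality is exactly β x^c.
  set t := (β * (c / a)) ^ (a / c) with ht
  have ht0 : 0 < t := by positivity
  have hy := Real.young_inequality_of_nonneg (a := x ^ a * t) (b := α / t) (by positivity)
    (by positivity) hconj
  have e1 : x ^ a * t * (α / t) = α * x ^ a := by field_simp
  have e2 : (x ^ a * t) ^ (c / a) / (c / a) = β * x ^ c := by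
    rw [Real.mul_rpow (by positivity) ht0.le, ← Real.rpow_mul hx.le, ht,
      ← Real.rpow_mul (by positivity), mul_div_cancel₀ _ ha.ne',
      div_mul_div_cancel₀ hc.ne', div_self ha.ne', Real.rpow_one]
    field_simp
  have e3 : (α / t) ^ (c / (c - a)) / (c / (c - a)) =
      (c - a) / c * (a / c) ^ (a / (c - a)) * α ^ (c / (c - a)) * β ^ (-(a / (c - a))) := by
    rw [Real.div_rpow hα ht0.le, ht, ← Real.rpow_mul (by positivity),
      div_mul_div_cancel₀ hc.ne', Real.mul_rpow hβ.le (by positivity), Real.rpow_neg hβ.le,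
      ← inv_div c a, Real.inv_rpow (by positivity)]
    field_simp
  rw [e1, e2, e3] at hy
  linarith

/-- The constant in `∫|w|^(m+1) ≤ K (∫|w|^(q+1))^(η₁/η₂) (∫|w'|^p)^((m-q)/η₂)`. -/
noncomputable def powConst (p q m : ℝ) : ℝ :=
  eta2 p q / eta1 p m * ((p - 1) * (m - q) / eta1 p m) ^ ((p - 1) * (m - q) / eta2 p q) *
    (2 * profileIntegral p q m) ^ (-(p * (m - q) / eta2 p q))

section Inequality

variable {p q m : ℝ} {w g : ℝ → ℝ}

lemma holderConjugate_conjugate (hp : 1 < p) : p.HolderConjugate (p / (p - 1)) :=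
  Real.HolderConjugate.conjExponent hp

lemma integrable_mul_of_rpow (hp : 1 < p) {f : ℝ → ℝ} (hg : AEStronglyMeasurable g volume)
    (hgp : Integrable fun x => |g x| ^ p) (hf : AEStronglyMeasurable f volume)
    (hfp : Integrable fun x => |f x| ^ (p / (p - 1))) (hf0 : ∀ x, 0 ≤ f x) :
    Integrable (fun x => |g x| * f x) ∧ ∫ x, |g x| * f x ≤
      (∫ x, |g x| ^ p) ^ (1 / p) * (∫ x, |f x| ^ (p / (p - 1))) ^ ((p - 1) / p) := by
  have hp0 : 0 < p := by linarith
  have hp' : 0 < p / (p - 1) := div_pos hp0 (by linarith)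
  have h1 : MemLp (fun x => |g x|) (ENNReal.ofReal p) := by
    refine (integrable_norm_rpow_iff hg.norm (by simpa using hp0) ENNReal.ofReal_ne_top).1 ?_
    simpa [ENNReal.toReal_ofReal hp0.le] using hgp
  have h2 : MemLp f (ENNReal.ofReal (p / (p - 1))) := by
    refine (integrable_norm_rpow_iff hf (by simpa using hp') ENNReal.ofReal_ne_top).1 ?_
    simpa [ENNReal.toReal_ofReal hp'.le] using hfp
  have hconj := holderConjugate_conjugate hp
  constructor
  · have : (ENNReal.ofReal p).HolderConjugate (ENNReal.ofReal (p / (p - 1))) :=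
      hconj.ennrealOfReal
    exact h1.integrable_mul h2
  · have := integral_mul_le_Lp_mul_Lq_of_nonneg hconj (μ := volume)
      (Eventually.of_forall fun x => abs_nonneg (g x)) (Eventually.of_forall hf0) h1 h2
    rw [one_div_div] at this
    simpa only [abs_of_nonneg (hf0 _)] using this

/-- A preliminary, non-sharp use of the sweeping bound with H(t) = |t|^e, which makes the supremum
finite. The exponent e is chosen so that H(w)^(p/(p-1)) = |w|^(q+1) is integrable. -/
lemma _root_.IsLebesguePrimitive.exists_abs_le (h : IsLebesguePrimitive w g) (hp : 1 < p)
    (hq : 0 < q + 1) (hgp : Integrable fun x => |g x| ^ p)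
    (hw : Integrable fun x => |w x| ^ (q + 1)) : ∃ C, ∀ x, |w x| ≤ C := by
  have ha : 0 < (p - 1) / p := div_pos (by linarith) (by linarith)
  set e := (q + 1) * ((p - 1) / p) with he
  have he0 : 0 < e := mul_pos hq ha
  have hcont : Continuous fun s : ℝ => |s| ^ e :=
    (Real.continuous_rpow_const he0.le).comp continuous_abs
  have hpow : ∀ x, |(|w x| ^ e)| ^ (p / (p - 1)) = |w x| ^ (q + 1) := fun x => by
    rw [abs_of_nonneg (by positivity), ← Real.rpow_mul (abs_nonneg _)]
    congr 1; rw [he]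
    have : p - 1 ≠ 0 := by linarith
    field_simp
  have hint := (integrable_mul_of_rpow hp h.1.aestronglyMeasurable hgp
    (hcont.comp h.continuous).aestronglyMeasurable (by simpa only [Function.comp_apply, hpow] using hw)
    (fun x => by simp only [Function.comp_apply]; positivity)).1
  -- The maximum with 1 allows |w x| to be bounded by |w x|^(e+1).
  refine ⟨max 1 (((e + 1) * ∫ x, |g x| * |w x| ^ e) + 1), fun x => ?_⟩
  by_contra! hlt
  have h1 : 1 < |w x| := (le_max_left _ _).trans_lt hlt
  have h2 := h.two_mul_integral_le hq hw hcont (fun t => by positivity) (fun t => by rw [abs_neg])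
    hint x
  have h3 : ∫ t in (0 : ℝ)..|w x|, |t| ^ e = |w x| ^ (e + 1) / (e + 1) := by
    have : ∫ t in (0 : ℝ)..|w x|, |t| ^ e = ∫ t in (0 : ℝ)..|w x|, t ^ e := by
      refine intervalIntegral.integral_congr fun t ht => ?_
      rw [uIcc_of_le (abs_nonneg _)] at ht
      simp only [abs_of_nonneg ht.1]
    rw [this, integral_rpow (Or.inl (by linarith)), Real.zero_rpow (by linarith), sub_zero]
  rw [h3] at h2
  have h4 : |w x| ≤ |w x| ^ (e + 1) := by
    have := Real.rpow_le_rpow_of_exponent_le h1.le (show 1 ≤ e + 1 by linarith)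
    rwa [Real.rpow_one] at this
  have h5 : |w x| ^ (e + 1) ≤ (e + 1) * ∫ x, |g x| * |w x| ^ e := by
    have h6 : |w x| ^ (e + 1) / (e + 1) ≤ ∫ x, |g x| * |w x| ^ e := by
      have : 0 ≤ |w x| ^ (e + 1) / (e + 1) := by positivity
      linarith
    rwa [div_le_iff₀' (by linarith)] at h6
  have := (le_max_right 1 (((e + 1) * ∫ x, |g x| * |w x| ^ e) + 1)).trans_lt hlt
  linarith

/-- The interpolation inequality with the height `M = sup |w|` as a parameter. -/
lemma _root_.IsLebesguePrimitive.sup_interpolation (h : IsLebesguePrimitive w g) (hp : 1 < p)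
    (hq : 0 < q + 1) (hm : q < m) (hgp : Integrable fun x => |g x| ^ p)
    (hw : Integrable fun x => |w x| ^ (q + 1)) {M : ℝ} (hM : 0 < M)
    (hlub : IsLUB (range fun x => |w x|) M) :
    Integrable (fun x => |w x| ^ (m + 1)) ∧
      2 * (M ^ (1 + (m + 1) * ((p - 1) / p)) * profileIntegral p q m) ≤
        (∫ x, |g x| ^ p) ^ (1 / p) *
          (M ^ (m - q) * (∫ x, |w x| ^ (q + 1)) - ∫ x, |w x| ^ (m + 1)) ^ ((p - 1) / p) := by
  have ha : 0 < (p - 1) / p := div_pos (by linarith) (by linarith)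
  have hm1 : 0 < m + 1 := by linarith
  have hwM : ∀ x, |w x| ≤ M := fun x => hlub.1 ⟨x, rfl⟩
  have hbound : ∀ s, 0 ≤ s → s ≤ M → s ^ (m + 1) ≤ M ^ (m - q) * s ^ (q + 1) := by
    intro s hs hsM
    rw [show m + 1 = (m - q) + (q + 1) by ring, Real.rpow_add' hs (by linarith)]
    have : s ^ (m - q) ≤ M ^ (m - q) := Real.rpow_le_rpow hs hsM (by linarith)
    gcongr
  have hwm : Integrable fun x => |w x| ^ (m + 1) := by
    refine Integrable.mono' (hw.const_mul (M ^ (m - q)))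
      ((Real.continuous_rpow_const hm1.le).comp h.continuous.abs).aestronglyMeasurable
      (Eventually.of_forall fun x => ?_)
    rw [Real.norm_of_nonneg (by positivity)]
    exact hbound _ (abs_nonneg _) (hwM x)
  refine ⟨hwm, ?_⟩
  -- This weight turns ∫H(w)^(p/(p-1)) into M^(m-q)∫|w|^(q+1) - ∫|w|^(m+1), and for M = `peak` it is
  -- proportional to |u'|^(p-1) along the ground state. The positive part makes it continuous on the
  -- whole line; it is inactive for |s| ≤ M.
  set H : ℝ → ℝ := fun s => (max 0 (M ^ (m - q) * |s| ^ (q + 1) - |s| ^ (m + 1))) ^ ((p - 1) / p)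
    with hH
  have hHc : Continuous H := (Real.continuous_rpow_const ha.le).comp
    (continuous_const.max ((((Real.continuous_rpow_const hq.le).comp continuous_abs).const_mul _).sub
      ((Real.continuous_rpow_const hm1.le).comp continuous_abs)))
  have hH0 : ∀ s, 0 ≤ H s := fun s => Real.rpow_nonneg (le_max_left _ _) _
  have hHw : ∀ x, |H (w x)| ^ (p / (p - 1)) = M ^ (m - q) * |w x| ^ (q + 1) - |w x| ^ (m + 1) := by
    intro x
    have h1 : 0 ≤ M ^ (m - q) * |w x| ^ (q + 1) - |w x| ^ (m + 1) :=
      sub_nonneg.2 (hbound _ (abs_nonneg _) (hwM x))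
    rw [abs_of_nonneg (hH0 _)]
    simp only [hH]
    rw [max_eq_right h1, ← Real.rpow_mul h1]
    have : (p - 1) / p * (p / (p - 1)) = 1 := by
      have : p - 1 ≠ 0 := by linarith
      field_simp
    rw [this, Real.rpow_one]
  have hint := integrable_mul_of_rpow hp h.1.aestronglyMeasurable hgp
    (f := fun x => H (w x)) (hHc.comp h.continuous).aestronglyMeasurable
    (by simp only [hHw]; exact (hw.const_mul _).sub hwm) (fun x => hH0 _)
  have hright : ∫ x, |H (w x)| ^ (p / (p - 1)) =
      M ^ (m - q) * (∫ x, |w x| ^ (q + 1)) - ∫ x, |w x| ^ (m + 1) := by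
    simp only [hHw]
    rw [integral_sub (hw.const_mul _) hwm, integral_const_mul]
  rw [← hright]
  refine le_trans ?_ hint.2
  have hGc : Continuous fun y => 2 * ∫ t in (0 : ℝ)..y, H t :=
    (intervalIntegral.continuous_primitive (fun a b => hHc.intervalIntegrable a b) 0).const_mul 2
  -- Attainment of the supremum M is not needed: the bound holds at every height |w x|, and the set
  -- of heights where it holds is closed.
  have hclosed : IsClosed {y | 2 * ∫ t in (0 : ℝ)..y, H t ≤ ∫ x, |g x| * H (w x)} :=
    isClosed_le hGc continuous_const
  have hmem : M ∈ {y | 2 * ∫ t in (0 : ℝ)..y, H t ≤ ∫ x, |g x| * H (w x)} := by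
    refine closure_minimal ?_ hclosed (hlub.mem_closure (range_nonempty _))
    rintro _ ⟨x, rfl⟩
    exact h.two_mul_integral_le hq hw hHc hH0 (fun t => by simp only [hH, abs_neg]) hint.1 x
  have heq : ∫ t in (0 : ℝ)..M, H t =
      ∫ s in (0 : ℝ)..M, (M ^ (m - q) * s ^ (q + 1) - s ^ (m + 1)) ^ ((p - 1) / p) := by
    refine intervalIntegral.integral_congr fun t ht => ?_
    rw [uIcc_of_le hM.le] at ht
    simp only [hH]
    rw [abs_of_nonneg ht.1, max_eq_right (sub_nonneg.2 (hbound t ht.1 ht.2))]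
  rw [mem_ofPred_eq, heq, integral_scaled_profile hp hq hm hM] at hmem
  exact hmem

lemma eta1_pos (hp : 1 < p) (hm : 0 < m + 1) : 0 < eta1 p m := by
  have := mul_pos (sub_pos.2 hp) hm
  unfold eta1; linarith

lemma eta2_pos (hp : 1 < p) (hq : 0 < q + 1) : 0 < eta2 p q := by
  have := mul_pos (sub_pos.2 hp) hq
  unfold eta2; linarith

lemma eta1_sub_eta2 : eta1 p m - eta2 p q = (p - 1) * (m - q) := by
  unfold eta1 eta2; ring

/-- Eliminating the height from `sup_interpolation`. -/
lemma le_powConst_of_sup (hp : 1 < p) (hq : 0 < q + 1) (hm : q < m) {A B P M : ℝ} (hM : 0 < M)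
    (hB : 0 ≤ B) (hP : 0 ≤ P) (hA : A ≤ M ^ (m - q) * B)
    (hmain : 2 * (M ^ (1 + (m + 1) * ((p - 1) / p)) * profileIntegral p q m) ≤
      P ^ (1 / p) * (M ^ (m - q) * B - A) ^ ((p - 1) / p)) :
    A ≤ powConst p q m * B ^ (eta1 p m / eta2 p q) * P ^ ((m - q) / eta2 p q) := by
  have hp0 : 0 < p := by linarith
  have hp1 : 0 < p - 1 := by linarith
  have hD := profileIntegral_pos hp hq hm
  have hη1 := eta1_pos hp (show 0 < m + 1 by linarith)
  have hη2 := eta2_pos hp hq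
  have hηs : eta1 p m - eta2 p q = (p - 1) * (m - q) := eta1_sub_eta2
  have hmq : 0 < m - q := by linarith
  set N := 2 * profileIntegral p q m with hN
  have hN0 : 0 < N := by positivity
  -- The left side of the main inequality is positive because M > 0, which excludes zero energy.
  have hP0 : 0 < P := by
    rcases hP.eq_or_lt with h0 | h0
    · rw [← h0, Real.zero_rpow (by positivity), zero_mul] at hmain
      have : 0 < 2 * (M ^ (1 + (m + 1) * ((p - 1) / p)) * profileIntegral p q m) := by positivity
      linarith
    · exact h0
  have hdiff : 0 ≤ M ^ (m - q) * B - A := sub_nonneg.2 hA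
  rw [show 2 * (M ^ (1 + (m + 1) * ((p - 1) / p)) * profileIntegral p q m) =
      N * M ^ (1 + (m + 1) * ((p - 1) / p)) by rw [hN]; ring] at hmain
  have h1 := Real.rpow_le_rpow (by positivity) hmain (show 0 ≤ p / (p - 1) by positivity)
  rw [Real.mul_rpow (x := P ^ (1 / p)) (by positivity) (by positivity), ← Real.rpow_mul hP, ← Real.rpow_mul hdiff,
    show 1 / p * (p / (p - 1)) = 1 / (p - 1) by field_simp,
    show (p - 1) / p * (p / (p - 1)) = 1 by field_simp, Real.rpow_one,
    Real.mul_rpow hN0.le (by positivity), ← Real.rpow_mul hM.le,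
    show (1 + (m + 1) * ((p - 1) / p)) * (p / (p - 1)) = eta1 p m / (p - 1) by
      unfold eta1; field_simp; ring] at h1
  have hPp : 0 < P ^ (1 / (p - 1)) := by positivity
  set β := N ^ (p / (p - 1)) / P ^ (1 / (p - 1)) with hβ
  have h2 : A ≤ B * M ^ (m - q) - β * M ^ (eta1 p m / (p - 1)) := by
    have : β * M ^ (eta1 p m / (p - 1)) ≤ M ^ (m - q) * B - A := by
      rw [hβ, div_mul_eq_mul_div, div_le_iff₀' hPp]; exact h1
    linarith
  have hca : eta1 p m / (p - 1) - (m - q) = eta2 p q / (p - 1) := by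
    rw [eq_div_iff hp1.ne', sub_mul, div_mul_cancel₀ _ hp1.ne']; linarith
  -- The bound on A has the form B M^(m-q) - β M^(η₁/(p-1)); replacing it by the maximum over all
  -- heights eliminates M.
  have h3 := rpow_sub_rpow_le (a := m - q) (c := eta1 p m / (p - 1)) (β := β) hmq
    (by rw [← sub_pos, hca]; positivity) hB (by positivity) hM
  rw [hca] at h3
  refine (h2.trans h3).trans_eq ?_
  rw [powConst, ← hN,
    show eta2 p q / (p - 1) / (eta1 p m / (p - 1)) = eta2 p q / eta1 p m by field_simp,
    show (m - q) / (eta1 p m / (p - 1)) = (p - 1) * (m - q) / eta1 p m by field_simp,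
    show (m - q) / (eta2 p q / (p - 1)) = (p - 1) * (m - q) / eta2 p q by field_simp,
    show eta1 p m / (p - 1) / (eta2 p q / (p - 1)) = eta1 p m / eta2 p q by field_simp,
    hβ, Real.div_rpow (by positivity) hPp.le, ← Real.rpow_mul hN0.le, ← Real.rpow_mul hP,
    show p / (p - 1) * -((p - 1) * (m - q) / eta2 p q) = -(p * (m - q) / eta2 p q) by field_simp,
    show 1 / (p - 1) * -((p - 1) * (m - q) / eta2 p q) = -((m - q) / eta2 p q) by field_simp,
    Real.rpow_neg hP, div_inv_eq_mul]
  ring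

/-- The sharp interpolation inequality in terms of integrals. -/
lemma _root_.IsLebesguePrimitive.interpolation (h : IsLebesguePrimitive w g) (hp : 1 < p)
    (hq : 0 < q + 1) (hm : q < m) (hgp : Integrable fun x => |g x| ^ p)
    (hw : Integrable fun x => |w x| ^ (q + 1)) :
    Integrable (fun x => |w x| ^ (m + 1)) ∧ ∫ x, |w x| ^ (m + 1) ≤
      powConst p q m * (∫ x, |w x| ^ (q + 1)) ^ (eta1 p m / eta2 p q) *
        (∫ x, |g x| ^ p) ^ ((m - q) / eta2 p q) := by
  have hm1 : 0 < m + 1 := by linarith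
  have hB : 0 ≤ ∫ x, |w x| ^ (q + 1) := integral_nonneg fun x => by positivity
  have hP : 0 ≤ ∫ x, |g x| ^ p := integral_nonneg fun x => by positivity
  obtain ⟨C, hC⟩ := h.exists_abs_le hp hq hgp hw
  have hlub := isLUB_csSup (range_nonempty fun x => |w x|)
    ⟨C, by rintro _ ⟨x, rfl⟩; exact hC x⟩
  set M := sSup (range fun x => |w x|)
  have hM : 0 ≤ M := (abs_nonneg (w 0)).trans (hlub.1 ⟨0, rfl⟩)
  rcases hM.eq_or_lt with h0 | h0
  -- Zero supremum means w = 0, where the left side is 0 and the right side is nonnegative.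
  · have hw0 : ∀ x, |w x| = 0 := fun x =>
      le_antisymm (h0 ▸ hlub.1 ⟨x, rfl⟩) (abs_nonneg _)
    simp only [hw0, Real.zero_rpow hm1.ne']
    refine ⟨integrable_zero _ _ _, ?_⟩
    have hD := profileIntegral_pos hp hq hm
    have hη1 := eta1_pos hp hm1
    have hη2 := eta2_pos hp hq
    have : 0 ≤ (p - 1) * (m - q) / eta1 p m :=
      div_nonneg (mul_nonneg (by linarith) (by linarith)) hη1.le
    simp only [integral_zero, Real.zero_rpow hq.ne']
    unfold powConst
    positivity
  · obtain ⟨hwm, hmain⟩ := h.sup_interpolation hp hq hm hgp hw h0 hlub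
    refine ⟨hwm, le_powConst_of_sup hp hq hm h0 hB hP ?_ hmain⟩
    rw [← integral_const_mul]
    refine integral_mono hwm (hw.const_mul _) fun x => ?_
    simp only
    rw [show m + 1 = (m - q) + (q + 1) by ring, Real.rpow_add' (abs_nonneg _) (by linarith)]
    have : |w x| ^ (m - q) ≤ M ^ (m - q) :=
      Real.rpow_le_rpow (abs_nonneg _) (hlub.1 ⟨x, rfl⟩) (by linarith)
    gcongr

end Inequality

end GNOneDim

/-! ### Identification of the constants -/

namespace GNOneDim

section Constants

variable {p q m : ℝ}

lemma intervalIntegrable_beta {a b : ℝ} (ha : 0 < a) (hb : 1 ≤ b) :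
    IntervalIntegrable (fun t : ℝ => t ^ (a - 1) * (1 - t) ^ (b - 1)) volume 0 1 :=
  (intervalIntegral.intervalIntegrable_rpow' (by linarith)).mul_continuousOn
    ((Real.continuous_rpow_const (sub_nonneg.2 hb)).comp
      (continuous_const.sub continuous_id)).continuousOn

/-- Factor out t^(q+1) and substitute x = t^(m-q). -/
lemma profileIntegral_eq (hp : 1 < p) (hq : 0 < q + 1) (hm : q < m) :
    profileIntegral p q m = completeBeta (eta2 p q / (p * (m - q))) ((2 * p - 1) / p) / (m - q) := by
  have hp0 : 0 < p := by linarith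
  have hmq : 0 < m - q := by linarith
  have ha : 0 < (p - 1) / p := div_pos (by linarith) hp0
  have hη := eta2_pos hp hq
  set a := eta2 p q / (p * (m - q)) with ha_def
  have ha0 : 0 < a := by positivity
  have hb : (2 * p - 1) / p - 1 = (p - 1) / p := by field_simp; ring
  have hb1 : 1 ≤ (2 * p - 1) / p := by linarith
  set f : ℝ → ℝ := fun t => t ^ (m - q) with hf
  set k : ℝ → ℝ := fun t => t ^ (a - 1) * (1 - t) ^ ((2 * p - 1) / p - 1) with hk
  have hf01 : ∀ t ∈ Icc (0 : ℝ) 1, f t ∈ Icc (0 : ℝ) 1 := fun t ht =>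
    ⟨Real.rpow_nonneg ht.1 _, Real.rpow_le_one ht.1 ht.2 hmq.le⟩
  have hcongr : ∀ t ∈ Ioc (0 : ℝ) 1, k (f t) * ((m - q) * t ^ (m - q - 1)) =
      (m - q) * (t ^ (q + 1) - t ^ (m + 1)) ^ ((p - 1) / p) := by
    intro t ht
    have ht0 : 0 < t := ht.1
    have hle : 0 ≤ 1 - t ^ (m - q) := sub_nonneg.2 (Real.rpow_le_one ht.1.le ht.2 hmq.le)
    have h1 : t ^ (q + 1) - t ^ (m + 1) = t ^ (q + 1) * (1 - t ^ (m - q)) := by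
      rw [mul_sub, mul_one, ← Real.rpow_add ht0]; ring_nf
    have h2 : t ^ ((q + 1) * ((p - 1) / p)) = t ^ ((m - q) * (a - 1)) * t ^ (m - q - 1) := by
      rw [← Real.rpow_add ht0]; congr 1; rw [ha_def, eta2]; field_simp; ring
    simp only [hk, hf]
    rw [h1, Real.mul_rpow (by positivity) hle, ← Real.rpow_mul ht0.le, ← Real.rpow_mul ht0.le, h2,
      hb]
    ring
  have hcontR : Continuous fun t : ℝ => (m - q) * (t ^ (q + 1) - t ^ (m + 1)) ^ ((p - 1) / p) :=
    ((Real.continuous_rpow_const ha.le).comp ((Real.continuous_rpow_const hq.le).sub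
      (Real.continuous_rpow_const (by linarith)))).const_mul _
  have hsub := intervalIntegral.integral_comp_mul_deriv''' (a := 0) (b := 1) (f := f)
    (f' := fun t => (m - q) * t ^ (m - q - 1)) (g := k)
    (Real.continuous_rpow_const hmq.le).continuousOn
    (fun t ht => (Real.hasDerivAt_rpow_const (Or.inl (by
      rw [min_eq_left zero_le_one] at ht; exact ht.1.ne'))).hasDerivWithinAt) ?_ ?_ ?_
  · have e1 : f 0 = 0 := Real.zero_rpow hmq.ne'
    have e2 : f 1 = 1 := Real.one_rpow _
    rw [e1, e2] at hsub
    have e3 : ∫ t in (0 : ℝ)..1, (k ∘ f) t * ((m - q) * t ^ (m - q - 1)) =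
        (m - q) * profileIntegral p q m := by
      rw [profileIntegral, ← intervalIntegral.integral_const_mul]
      refine intervalIntegral.integral_congr_ae (Eventually.of_forall fun t ht => ?_)
      rw [uIoc_of_le zero_le_one] at ht
      exact hcongr t ht
    rw [e3] at hsub
    rw [eq_div_iff hmq.ne', mul_comm, hsub]
    rfl
  · rintro _ ⟨t, ht, rfl⟩
    rw [min_eq_left zero_le_one, max_eq_right zero_le_one] at ht
    have h1 : 0 < f t := Real.rpow_pos_of_pos ht.1 _
    have h2 : f t < 1 := Real.rpow_lt_one ht.1.le ht.2 hmq
    exact ((continuousAt_id.rpow_const (Or.inl h1.ne')).mul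
      ((continuousAt_const.sub continuousAt_id).rpow_const
      (Or.inl (sub_pos.2 h2).ne'))).continuousWithinAt
  · rw [uIcc_of_le zero_le_one]
    refine IntegrableOn.mono_set (t := Icc 0 1) ?_ (by rintro _ ⟨t, ht, rfl⟩; exact hf01 t ht)
    exact (intervalIntegrable_iff_integrableOn_Icc_of_le zero_le_one).1
      (intervalIntegrable_beta ha0 hb1)
  · rw [uIcc_of_le zero_le_one, integrableOn_Icc_iff_integrableOn_Ioc]
    exact IntegrableOn.congr_fun (hcontR.integrableOn_Icc.mono_set Ioc_subset_Icc_self)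
      (fun t ht => (hcongr t ht).symm) measurableSet_Ioc

/-- The base of the power defining `sharpConst`, through its logarithm. -/
lemma sharpConst_pos_and_log (hp : 1 < p) (hq : 0 < q + 1) (hm : q < m) :
    0 < sharpConst p q m ∧ Real.log (sharpConst p q m) = -ell p q m *
      (p * Real.log 2 + (1 - p) * Real.log (p - 1) + eta1 p m / (m - q) * Real.log (eta1 p m)
        - (2 * p - 1) * Real.log (m - q) - eta2 p q / (m - q) * Real.log (eta2 p q)
        + p * (Real.log (profileIntegral p q m) + Real.log (m - q))) := by
  have hp1 : 0 < p - 1 := by linarith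
  have hmq : 0 < m - q := by linarith
  have hη1 := eta1_pos hp (show 0 < m + 1 by linarith)
  have hη2 := eta2_pos hp hq
  have hD := profileIntegral_pos hp hq hm
  have hB : completeBeta (eta2 p q / (p * (m - q))) ((2 * p - 1) / p) =
      profileIntegral p q m * (m - q) := by
    rw [profileIntegral_eq hp hq hm, div_mul_cancel₀ _ hmq.ne']
  rw [sharpConst, hB]
  constructor
  · positivity
  · rw [Real.log_rpow (by positivity), Real.log_mul (by positivity) (by positivity),
      Real.log_div (by positivity) (by positivity), Real.log_mul (by positivity) (by positivity),
      Real.log_mul (by positivity) (by positivity), Real.log_mul (by positivity) (by positivity),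
      Real.log_rpow two_pos, Real.log_rpow hp1, Real.log_rpow hη1, Real.log_rpow hmq,
      Real.log_rpow hη2, Real.log_rpow (by positivity), Real.log_mul hD.ne' hmq.ne']
    ring

lemma sharpConst_pos (hp : 1 < p) (hq : 0 < q + 1) (hm : q < m) : 0 < sharpConst p q m :=
  (sharpConst_pos_and_log hp hq hm).1

/-- After taking logarithms both sides are linear in the same few logarithms, and the coefficients
agree because η₁ = η₂ + (p-1)(m-q). -/
lemma powConst_eq (hp : 1 < p) (hq : 0 < q + 1) (hm : q < m) :
    powConst p q m = sharpConst p q m ^ (m + 1) := by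
  have hp1 : 0 < p - 1 := by linarith
  have hmq : 0 < m - q := by linarith
  have hm1 : 0 < m + 1 := by linarith
  have hη1 := eta1_pos hp hm1
  have hη2 := eta2_pos hp hq
  have hD := profileIntegral_pos hp hq hm
  obtain ⟨hs, hlog⟩ := sharpConst_pos_and_log hp hq hm
  refine Real.log_injOn_pos (mem_Ioi.2 ?_) (mem_Ioi.2 (by positivity)) ?_
  · unfold powConst; positivity
  rw [Real.log_rpow hs, hlog, powConst, Real.log_mul (by positivity) (by positivity),
    Real.log_mul (by positivity) (by positivity), Real.log_div hη2.ne' hη1.ne',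
    Real.log_rpow (by positivity), Real.log_rpow (by positivity),
    Real.log_div (by positivity) hη1.ne', Real.log_mul hp1.ne' hmq.ne',
    Real.log_mul two_ne_zero hD.ne', ell]
  have e1 : (p - 1) * (q + 1) + p = eta2 p q := rfl
  have e2 : eta1 p m = eta2 p q + (p - 1) * (m - q) := by linarith [eta1_sub_eta2 (p := p) (q := q) (m := m)]
  rw [e1]
  -- log η₁ is frozen as an independent variable before η₁ is rewritten through η₂ in the
  -- coefficients.
  generalize Real.log (eta1 p m) = L1
  rw [e2]
  field_simp
  ring

lemma theta_eq : theta p q m = p * (m - q) / ((m + 1) * eta2 p q) := by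
  unfold theta eta2; congr 2; ring

lemma theta_pos (hp : 1 < p) (hq : 0 < q + 1) (hm : q < m) : 0 < theta p q m := by
  rw [theta_eq]
  exact div_pos (mul_pos (by linarith) (by linarith)) (mul_pos (by linarith) (eta2_pos hp hq))

lemma one_sub_theta (hp : 1 < p) (hq : 0 < q + 1) (hm : q < m) :
    1 - theta p q m = (q + 1) * eta1 p m / ((m + 1) * eta2 p q) := by
  have h1 := (eta2_pos hp hq).ne'
  have h2 : m + 1 ≠ 0 := by linarith
  rw [theta_eq, eq_div_iff (mul_ne_zero h2 h1), sub_mul, div_mul_cancel₀ _ (mul_ne_zero h2 h1)]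
  unfold eta1 eta2; ring

lemma one_sub_theta_pos (hp : 1 < p) (hq : 0 < q + 1) (hm : q < m) : 0 < 1 - theta p q m := by
  have hm1 : 0 < m + 1 := by linarith
  have h1 := eta1_pos hp hm1
  have h2 := eta2_pos hp hq
  rw [one_sub_theta hp hq hm]
  positivity

/-- The scaling relation between the exponents. -/
lemma theta_scaling (hp : 1 < p) (hq : 0 < q + 1) (hm : q < m) :
    1 / (m + 1) - (1 - theta p q m) / (q + 1) - theta p q m / p = -theta p q m := by
  have h1 := (eta2_pos hp hq).ne'
  have h2 : m + 1 ≠ 0 := by linarith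
  have h3 : p ≠ 0 := by linarith
  rw [one_sub_theta hp hq hm, theta_eq]
  field_simp
  unfold eta1 eta2
  ring

/-- `massConst` is the quotient of norms when the three norms are in the ratios forced on a
ground state. -/
lemma massConst_mul (hp : 1 < p) (hq : 0 < q + 1) (hm : q < m) {M : ℝ} (hM : 0 < M) :
    massConst p q m M * (M ^ (1 / (q + 1))) ^ (1 - theta p q m) *
      ((theta p q m * M / (1 - theta p q m)) ^ (1 / p)) ^ theta p q m =
    (M / (1 - theta p q m)) ^ (1 / (m + 1)) := by
  have h0 := theta_pos hp hq hm
  have h1 := one_sub_theta_pos hp hq hm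
  have hs := theta_scaling hp hq hm
  set t := theta p q m
  have hmass : 0 < massConst p q m M := by
    unfold massConst; positivity
  refine Real.log_injOn_pos (mem_Ioi.2 (by positivity)) (mem_Ioi.2 (by positivity)) ?_
  rw [Real.log_mul (by positivity) (by positivity), Real.log_mul (by positivity) (by positivity),
    Real.log_rpow (by positivity), Real.log_rpow hM, Real.log_rpow (by positivity),
    Real.log_rpow (by positivity), Real.log_div (by positivity) h1.ne',
    Real.log_mul h0.ne' hM.ne', Real.log_rpow (by positivity), Real.log_div hM.ne' h1.ne',
    massConst, Real.log_mul (by positivity) (by positivity),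
    Real.log_mul (by positivity) (by positivity), Real.log_rpow (by positivity),
    Real.log_rpow (by positivity), Real.log_rpow hM]
  linear_combination Real.log M * (-hs)

end Constants

namespace IsPositiveSolution

variable {p q m : ℝ} {u : ℝ → ℝ}

/-- By the formula for the peak, (m+1) F(s) = peak^(m-q) s^(q+1) - s^(m+1). This is the integrand of
the interpolation inequality at height M = `peak`, so the same scaled integral appears. -/
lemma integral_deriv_rpow_eq (h : IsPositiveSolution p q m u) (hp : 1 < p) (hq : 0 < q + 1)
    (hm : q < m) : ∫ r in Ioi 0, |deriv u r| ^ p =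
      (p / (p - 1) / (m + 1)) ^ ((p - 1) / p) *
        (peak q m ^ (eta1 p m / p) * profileIntegral p q m) := by
  have hpk := peak_pos hq hm
  have hm1 : 0 < m + 1 := by linarith
  have hP : 0 < p / (p - 1) := div_pos (by linarith) (by linarith)
  rw [h.integral_deriv_rpow hp hq hm,
    show eta1 p m / p = 1 + (m + 1) * ((p - 1) / p) by
      have : p ≠ 0 := by linarith
      unfold eta1; field_simp; ring,
    ← integral_scaled_profile hp hq hm hpk, ← intervalIntegral.integral_const_mul]
  refine intervalIntegral.integral_congr fun s hs => ?_
  rw [uIcc_of_le hpk.le] at hs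
  have h1 : p / (p - 1) * potential q m s =
      p / (p - 1) / (m + 1) * (peak q m ^ (m - q) * s ^ (q + 1) - s ^ (m + 1)) := by
    rw [peak_rpow hq hm, potential]; field_simp
  have h2 : 0 ≤ peak q m ^ (m - q) * s ^ (q + 1) - s ^ (m + 1) := by
    rw [sub_nonneg, show m + 1 = (m - q) + (q + 1) by ring, Real.rpow_add' hs.1 (by linarith)]
    have : s ^ (m - q) ≤ peak q m ^ (m - q) := Real.rpow_le_rpow hs.1 hs.2 (by linarith)
    have := Real.rpow_nonneg hs.1 (q + 1)
    gcongr
  rw [h1, Real.mul_rpow (by positivity) h2]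

/-- All integrals of a ground state in terms of its energy. -/
lemma integrals_eq (h : IsPositiveSolution p q m u) (hp : 1 < p) (hq : 0 < q + 1)
    (hm : q < m) :
    ∫ r in Ioi 0, u r ^ (m + 1) = (∫ r in Ioi 0, u r ^ (q + 1)) / (1 - theta p q m) ∧
    ∫ r in Ioi 0, |deriv u r| ^ p =
      theta p q m * (∫ r in Ioi 0, u r ^ (q + 1)) / (1 - theta p q m) := by
  have h1 := (h.integral_energy hp hq hm).2
  have h2 := h.integral_nehari hp hq hm
  have hθ := one_sub_theta hp hq hm
  have hm1 : 0 < m + 1 := by linarith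
  have hη1 := (eta1_pos hp hm1).ne'
  have hη2 := (eta2_pos hp hq).ne'
  have hpos := (one_sub_theta_pos hp hq hm).ne'
  have hp1 : p - 1 ≠ 0 := by linarith
  set A := ∫ r in Ioi 0, u r ^ (m + 1)
  set B := ∫ r in Ioi 0, u r ^ (q + 1)
  set P := ∫ r in Ioi 0, |deriv u r| ^ p
  -- The energy identity and the equation tested with u are two linear relations among the three
  -- integrals A, B, P. Eliminating P gives A/B, and P = A - B then gives the rest.
  have hA : A = B / (1 - theta p q m) := by
    rw [hθ]
    rw [h1] at h2
    field_simp at h2 ⊢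
    unfold eta1 eta2
    linear_combination -h2
  refine ⟨hA, ?_⟩
  rw [h2, hA]
  field_simp
  ring

lemma integral_rpow_pos (h : IsPositiveSolution p q m u) (hp : 1 < p) (hq : 0 < q + 1)
    (hm : q < m) : 0 < ∫ r in Ioi 0, u r ^ (q + 1) := by
  have h1 := h.integral_deriv_rpow_eq hp hq hm
  have h2 := (h.integrals_eq hp hq hm).2
  have hm1 : 0 < m + 1 := by linarith
  have hP : 0 < p / (p - 1) := div_pos (by linarith) (by linarith)
  have hD := profileIntegral_pos hp hq hm
  have hpk := peak_pos hq hm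
  have hpos := one_sub_theta_pos hp hq hm
  have hθ := theta_pos hp hq hm
  have h3 : 0 < theta p q m * (∫ r in Ioi 0, u r ^ (q + 1)) / (1 - theta p q m) := by
    rw [← h2, h1]; positivity
  rw [div_pos_iff_of_pos_right hpos] at h3
  exact pos_of_mul_pos_right h3 hθ.le

/-- The energy is known in two ways, as θB/(1-θ) and as an explicit multiple of the profile
integral. Equating them determines the half-line mass B, and substitution into `massConst` is an
identity between logarithms. -/
lemma sharpConst_eq_massConst (h : IsPositiveSolution p q m u) (hp : 1 < p) (hq : 0 < q + 1)
    (hm : q < m) : sharpConst p q m = massConst p q m (2 * ∫ r in Ioi 0, u r ^ (q + 1)) := by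
  have hp0 : 0 < p := by linarith
  have hp1 : 0 < p - 1 := by linarith
  have hmq : 0 < m - q := by linarith
  have hm1 : 0 < m + 1 := by linarith
  have hη1 := eta1_pos hp hm1
  have hη2 := eta2_pos hp hq
  have hD := profileIntegral_pos hp hq hm
  have hpk := peak_pos hq hm
  have hBpos := h.integral_rpow_pos hp hq hm
  have hθ := theta_pos hp hq hm
  have hθ1 := one_sub_theta_pos hp hq hm
  obtain ⟨hs, hlog⟩ := sharpConst_pos_and_log hp hq hm
  have hP := (h.integrals_eq hp hq hm).2
  rw [h.integral_deriv_rpow_eq hp hq hm] at hP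
  set B := ∫ r in Ioi 0, u r ^ (q + 1)
  have hlogpk : Real.log (peak q m) = 1 / (m - q) * (Real.log (m + 1) - Real.log (q + 1)) := by
    rw [peak, Real.log_rpow (by positivity), Real.log_div hm1.ne' hq.ne']
  have hlogP := congrArg Real.log hP
  have hlθ : Real.log (theta p q m) =
      Real.log p + Real.log (m - q) - (Real.log (m + 1) + Real.log (eta2 p q)) := by
    rw [theta_eq, Real.log_div (by positivity) (by positivity), Real.log_mul hp0.ne' hmq.ne',
      Real.log_mul hm1.ne' hη2.ne']
  have hlθ1 : Real.log (1 - theta p q m) =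
      Real.log (q + 1) + Real.log (eta1 p m) - (Real.log (m + 1) + Real.log (eta2 p q)) := by
    rw [one_sub_theta hp hq hm, Real.log_div (by positivity) (by positivity),
      Real.log_mul hq.ne' hη1.ne', Real.log_mul hm1.ne' hη2.ne']
  rw [Real.log_mul (by positivity) (by positivity), Real.log_rpow (by positivity),
    Real.log_div (by positivity) hm1.ne', Real.log_div hp0.ne' hp1.ne',
    Real.log_mul (by positivity) hD.ne', Real.log_rpow hpk, hlogpk,
    Real.log_div (by positivity) hθ1.ne', Real.log_mul hθ.ne' hBpos.ne', hlθ, hlθ1] at hlogP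
  have hmass : 0 < massConst p q m (2 * B) := by
    unfold massConst; positivity
  refine Real.log_injOn_pos (mem_Ioi.2 hs) (mem_Ioi.2 hmass) ?_
  rw [hlog, massConst, Real.log_mul (by positivity) (by positivity),
    Real.log_mul (by positivity) (by positivity), Real.log_rpow hθ,
    Real.log_rpow hθ1, Real.log_rpow (by positivity), Real.log_mul two_ne_zero hBpos.ne', hlθ, hlθ1]
  have hlB : Real.log B = (p - 1) / p * (Real.log p - Real.log (p - 1) - Real.log (m + 1)) +
      (eta1 p m / p * (1 / (m - q) * (Real.log (m + 1) - Real.log (q + 1))) +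
        Real.log (profileIntegral p q m)) - (Real.log p + Real.log (m - q) -
        (Real.log (m + 1) + Real.log (eta2 p q))) + (Real.log (q + 1) + Real.log (eta1 p m) -
        (Real.log (m + 1) + Real.log (eta2 p q))) := by linarith
  rw [hlB, theta_eq, ell, show (p - 1) * (q + 1) + p = eta2 p q from rfl]
  generalize Real.log (eta1 p m) = L1
  generalize Real.log (eta2 p q) = L2
  generalize Real.log (m - q) = L3
  generalize Real.log (p - 1) = L4
  generalize Real.log (m + 1) = L5
  generalize Real.log (q + 1) = L6
  generalize Real.log (profileIntegral p q m) = L7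
  have e2 : eta1 p m = eta2 p q + (p - 1) * (m - q) := by
    linarith [eta1_sub_eta2 (p := p) (q := q) (m := m)]
  rw [e2]
  field_simp
  unfold eta2
  ring

end IsPositiveSolution

end GNOneDim

/-! ### Best constant and conclusion -/

namespace GNOneDim

variable {p q m : ℝ}

lemma eLpNorm_ofReal_eq {v : ℝ → ℝ} {s : ℝ} (hs : 0 < s) (hv : MemLp v (ENNReal.ofReal s)) :
    eLpNorm v (ENNReal.ofReal s) volume =
      ENNReal.ofReal ((∫ x, |v x| ^ s) ^ (1 / s)) := by
  rw [hv.eLpNorm_eq_integral_rpow_norm (by simpa using hs) ENNReal.ofReal_ne_top,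
    ENNReal.toReal_ofReal hs.le, one_div]
  rfl

lemma integrable_abs_rpow {v : ℝ → ℝ} {s : ℝ} (hs : 0 < s) (hv : MemLp v (ENNReal.ofReal s)) :
    Integrable fun x => |v x| ^ s := by
  have := (integrable_norm_rpow_iff hv.1 (by simpa using hs) ENNReal.ofReal_ne_top).2 hv
  rwa [ENNReal.toReal_ofReal hs.le] at this

lemma ofReal_mul_rpow_mul_rpow {K b c t : ℝ} (hK : 0 ≤ K) (hb : 0 ≤ b) (hc : 0 ≤ c)
    (ht : 0 ≤ t) (ht1 : 0 ≤ 1 - t) :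
    ENNReal.ofReal K * ENNReal.ofReal b ^ (1 - t) * ENNReal.ofReal c ^ t =
      ENNReal.ofReal (K * b ^ (1 - t) * c ^ t) := by
  rw [ENNReal.ofReal_rpow_of_nonneg hb ht1, ENNReal.ofReal_rpow_of_nonneg hc ht,
    ← ENNReal.ofReal_mul hK, ← ENNReal.ofReal_mul (by positivity)]

/-- Replace v by its absolutely continuous representative, apply the integral inequality and take
the (m+1)-th root; the exponents then become (1-θ)/(q+1) and θ/p. -/
lemma gnInequality_sharpConst (hp : 1 < p) (hq : 0 < q + 1) (hm : q < m) :
    GNInequality p q m (sharpConst p q m) := by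
  rintro v g ⟨hv, hg, hvg⟩
  have hp0 : 0 < p := by linarith
  have hm1 : 0 < m + 1 := by linarith
  obtain ⟨w, hwg, hvw⟩ := hvg.exists_primitive
  have hw : MemLp w (ENNReal.ofReal (q + 1)) := hv.ae_eq hvw
  obtain ⟨hwm, hmain⟩ := hwg.interpolation hp hq hm (integrable_abs_rpow hp0 hg)
    (integrable_abs_rpow hq hw)
  have hwm' : MemLp w (ENNReal.ofReal (m + 1)) := by
    rw [← integrable_norm_rpow_iff hw.1 (by simpa using hm1) ENNReal.ofReal_ne_top,
      ENNReal.toReal_ofReal hm1.le]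
    exact hwm
  have hθ := theta_pos hp hq hm
  have hθ1 := one_sub_theta_pos hp hq hm
  have hK := sharpConst_pos hp hq hm
  have hη1 := (eta1_pos hp hm1).ne'
  have hη2 := (eta2_pos hp hq).ne'
  rw [eLpNorm_congr_ae hvw, eLpNorm_congr_ae hvw, eLpNorm_ofReal_eq hm1 hwm',
    eLpNorm_ofReal_eq hq hw, eLpNorm_ofReal_eq hp0 hg]
  have hA : 0 ≤ ∫ x, |w x| ^ (m + 1) := integral_nonneg fun x => by positivity
  have hB : 0 ≤ ∫ x, |w x| ^ (q + 1) := integral_nonneg fun x => by positivity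
  have hP : 0 ≤ ∫ x, |g x| ^ p := integral_nonneg fun x => by positivity
  rw [ofReal_mul_rpow_mul_rpow hK.le (by positivity) (by positivity) hθ.le hθ1.le]
  refine ENNReal.ofReal_le_ofReal ?_
  have h1 := Real.rpow_le_rpow hA hmain (show 0 ≤ 1 / (m + 1) by positivity)
  refine h1.trans_eq ?_
  rw [powConst_eq hp hq hm, Real.mul_rpow (by positivity) (by positivity),
    Real.mul_rpow (by positivity) (by positivity), ← Real.rpow_mul hK.le, ← Real.rpow_mul hB,
    ← Real.rpow_mul hP, ← Real.rpow_mul hB, ← Real.rpow_mul hP, mul_one_div_cancel hm1.ne',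
    Real.rpow_one, one_sub_theta hp hq hm, theta_eq]
  have e1 : eta1 p m / eta2 p q * (1 / (m + 1)) =
      1 / (q + 1) * ((q + 1) * eta1 p m / ((m + 1) * eta2 p q)) := by field_simp
  have e2 : (m - q) / eta2 p q * (1 / (m + 1)) =
      1 / p * (p * (m - q) / ((m + 1) * eta2 p q)) := by field_simp
  rw [e1, e2]

namespace IsPositiveSolution

variable {u : ℝ → ℝ}

lemma integral_comp_abs_rpow (h : IsPositiveSolution p q m u) (s : ℝ) :
    ∫ x, |u (|x|)| ^ s = 2 * ∫ r in Ioi 0, u r ^ s := by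
  rw [← integral_comp_abs (f := fun r => u r ^ s)]
  simp only [abs_of_pos (h.pos _ (abs_nonneg _))]

lemma integral_deriv_comp_abs_rpow (h : IsPositiveSolution p q m u) :
    ∫ x, |deriv (fun x => u |x|) x| ^ p = 2 * ∫ r in Ioi 0, |deriv u r| ^ p := by
  rw [← integral_comp_abs (f := fun r => |deriv u r| ^ p)]
  exact (integral_congr_ae h.ae_abs_deriv_comp_abs).symm

/-- Any admissible constant is at least the quotient of norms of the ground state. -/
lemma massConst_le (h : IsPositiveSolution p q m u) (hp : 1 < p) (hq : 0 < q + 1) (hm : q < m)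
    {K : ℝ} (hK : 0 ≤ K) (hgn : GNInequality p q m K) :
    massConst p q m (2 * ∫ r in Ioi 0, u r ^ (q + 1)) ≤ K := by
  have hp0 : 0 < p := by linarith
  have hm1 : 0 < m + 1 := by linarith
  have hX := h.memX hp hq hm
  have hθ := theta_pos hp hq hm
  have hθ1 := one_sub_theta_pos hp hq hm
  have hBpos := h.integral_rpow_pos hp hq hm
  have hineq := hgn _ _ hX
  rw [eLpNorm_ofReal_eq hm1 (h.memLp_comp_abs hm1 (h.integrableOn_rpow' hp hq hm)),
    eLpNorm_ofReal_eq hq hX.1, eLpNorm_ofReal_eq hp0 hX.2.1, h.integral_comp_abs_rpow,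
    h.integral_comp_abs_rpow, h.integral_deriv_comp_abs_rpow, (h.integrals_eq hp hq hm).1,
    (h.integrals_eq hp hq hm).2, ← mul_div_assoc, ← mul_div_assoc,
    mul_left_comm 2 (theta p q m)] at hineq
  have hM : 0 < 2 * ∫ r in Ioi 0, u r ^ (q + 1) := by positivity
  set M := 2 * ∫ r in Ioi 0, u r ^ (q + 1)
  rw [ofReal_mul_rpow_mul_rpow hK (by positivity) (by positivity) hθ.le hθ1.le,
    ENNReal.ofReal_le_ofReal_iff (by positivity), ← massConst_mul hp hq hm hM,
    mul_assoc, mul_assoc] at hineq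
  exact le_of_mul_le_mul_right hineq (by positivity)

end IsPositiveSolution

/-- Minimality comes from testing with the even extension of the closed form, whose quotient of
norms is `massConst` and hence `sharpConst`. -/
lemma isBestConstant_sharpConst (hp : 1 < p) (hqp : p - 1 ≤ q) (hm : q < m) :
    IsBestConstant p q m (sharpConst p q m) := by
  have hq : 0 < q + 1 := by linarith
  refine ⟨⟨(sharpConst_pos hp hq hm).le, gnInequality_sharpConst hp hq hm⟩, fun K hK => ?_⟩
  have h := isPositiveSolution_closedForm hp hqp hm
  rw [h.sharpConst_eq_massConst hp hq hm]
  exact h.massConst_le hp hq hm hK.1 hK.2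

end GNOneDim

theorem theorem7p1 (p q : ℝ) (hp : 1 < p) (hq : p - 1 ≤ q) :
    (∀ m : ℝ, q < m →
      -- `B(·; 1 - 1/p, (p-1-q)/(p(m-q)))` is a bijection of `[0,1)` onto `[0,∞)`
      BijOn (fun x => GNOneDim.incBeta x (1 - 1 / p) ((p - 1 - q) / (p * (m - q))))
        (Ico 0 1) (Ici 0) ∧
      -- existence, uniqueness and closed form of the ground state
      (∀ u : ℝ → ℝ, GNOneDim.IsPositiveSolution p q m u ↔
        ∀ r : ℝ, 0 ≤ r → u r = GNOneDim.closedForm p q m r) ∧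
      -- the ground state is decreasing, and its even extension has the integrability of the
      -- admissible class
      (∀ u : ℝ → ℝ, GNOneDim.IsPositiveSolution p q m u →
        (∀ r : ℝ, 0 < r → deriv u r < 0) ∧
        ∃ g : ℝ → ℝ, GNOneDim.MemX p q (fun x => u |x|) g) ∧
      -- the best constant
      GNOneDim.IsBestConstant p q m (GNOneDim.sharpConst p q m) ∧
      (∀ u : ℝ → ℝ, GNOneDim.IsPositiveSolution p q m u →
        GNOneDim.sharpConst p q m =
          GNOneDim.massConst p q m (∫ x : ℝ, u |x| ^ (q + 1)))) ∧
    -- decay estimates, with `r_*` and `C` independent of `m`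
    (∃ rstar : ℝ, 0 < rstar ∧
      (p - 1 < q → ∃ C : ℝ, 0 < C ∧ ∀ m : ℝ, 2 * q + 1 < m →
        ∀ u : ℝ → ℝ, GNOneDim.IsPositiveSolution p q m u → ∀ r : ℝ, 2 * rstar ≤ r →
          u r + r * |deriv u r| ≤ C * r ^ (-(p / (q + 1 - p)))) ∧
      (q = p - 1 → ∃ C : ℝ, 0 < C ∧ ∀ m : ℝ, 2 * q + 1 < m →
        ∀ u : ℝ → ℝ, GNOneDim.IsPositiveSolution p q m u → ∀ r : ℝ, 2 * rstar ≤ r →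
          u r ≤ Real.exp (-(C * r)))) := by
  have hq0 : 0 < q + 1 := by linarith
  refine ⟨fun m hm => ?_, GNOneDim.unitRadius p q, GNOneDim.unitRadius_pos hp hq0, fun hpq => ?_,
    fun hpq => ?_⟩
  · obtain ⟨ha, ha1, hb⟩ := GNOneDim.beta_exponents hp hq hm
    refine ⟨GNOneDim.bijOn_incBeta ha ha1 hb, GNOneDim.isPositiveSolution_iff hp hq hm,
      fun u hu => ⟨hu.deriv_neg hp hq0 hm, _, hu.memX hp hq0 hm⟩,
      GNOneDim.isBestConstant_sharpConst hp hq hm, fun u hu => ?_⟩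
    rw [hu.sharpConst_eq_massConst hp hq0 hm, integral_comp_abs (f := fun r => u r ^ (q + 1))]
  · exact ⟨GNOneDim.decayConst p q, GNOneDim.decayConst_pos hp hpq,
      fun m hm u hu r hr => hu.algebraic_decay hp hpq hm hr⟩
  · refine ⟨GNOneDim.kappa p q * (1 / 2) ^ (1 / p) / 2, ?_,
      fun m hm u hu r hr => hu.exp_decay hp hpq hm hr⟩
    have := GNOneDim.kappa_pos hp hq0
    positivity
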